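/- Represent a partition of $[n]=\{1,\dots,n\}$ by its arcs $(i,j)$, where $i<j$ are consecutive elements of a block; a (perfect) matching of $[2n]$ is a partition of $[2n]$ all of whose blocks have size $2$. For $\tau\in S_k$, a partition of $[n]$ avoids $\tau$ if there are no $1\le i_1<\dots<i_{2k}\le n$ such that $(i_a,i_{2k+1-\tau(a)})$ is an arc for every $1\le a\le k$. Let $\mathcal M_n(\sigma,\tau)$ and $\mathcal P_n(\sigma,\tau)$ be the sets of matchings of $[2n]$ and of partitions of $[n]$, respectively, that avoid both $\sigma$ and $\tau$. Let $C(v,z)=\sum_{n\ge0}\sum_{D}v^{\mathrm{val}(D)}z^n$, where $D$ runs over the Dyck paths of semilength $n$ and $\mathrm{val}(D)$ is the number of valleys of $D$ (down steps immediately followed by an up step). Theorem. There is exactly one $H=H(v,z)\in\mathbb Q[v][[z]]$ with $\alpha H^3+\beta H^2+\gamma H+\delta=0$, where \begin{align*} \alpha&=v^2z^2,\\ \beta&=-2vz+2v(1-v)z^2+v^2z^2C(v,z),\\ \gamma&=1-2(1-v)z+(1-v)^2z^2-vz\,C(v,z),\\ \delta&=-1+\left(vz-(1-v)^2z^2\right)C(v,z).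 \end{align*} The substitution $H\left(\frac1z,\frac{z^2}{(1-z)^2}\right)$ is a well-defined formal power series in $z$, and for $\{\sigma,\tau\}\in\{\{123,231\},\{123,312\}\}$, $$\sum_{n\ge0}|\mathcal M_n(\sigma,\tau)|z^n=\frac1{1-zH(1,z)},\qquad \sum_{n\ge0}|\mathcal P_n(\sigma,\tau)|z^n=1+\frac{z(1-z)}{(1-z)^2-zH\left(\frac1z,\frac{z^2}{(1-z)^2}\right)}.$$ In particular $|\mathcal M_n(123,231)|=|\mathcal M_n(123,312)|$ and $|\mathcal P_n(123,231)|=|\mathcal P_n(123,312)|$ for all $n$. Nevertheless the two pairs are not shape-Wilf-equivalent: there is a Ferrers board $F$ (a finite left- and bottom-justified set of unit squares whose row lengths weakly decrease from bottom to top) such that the number of full rook placements on $F$ (sets of squares of $F$ with exactly one square in each row and in each column of $F$) avoiding both $123$ and $231$ differs from the number avoiding both $123$ and $312$. Here a placement avoids $\tau$ if, for each vertex $V=(a,b)$ of the border of $F$, the permutation given by the rooks inside $[0,a]\times[0,b]$ (columns numbered from left to right, rows from bottom to top) avoids $\tau$. -/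

import Mathlib

open scoped Polynomial PowerSeries LaurentSeries

noncomputable section

namespace ArcPatterns

/-! ### Patterns, partitions, matchings -/

/-- The pattern `123`, as a permutation of `{0, 1, 2}`. -/
def p123 : Equiv.Perm (Fin 3) := Equiv.refl _

/-- The pattern `231` (one-line notation, shifted to `{0, 1, 2}`). -/
def p231 : Equiv.Perm (Fin 3) where
  toFun := ![1, 2, 0]
  invFun := ![2, 0, 1]
  left_inv := by decide
  right_inv := by decide

/-- The pattern `312` (one-line notation, shifted to `{0, 1, 2}`). -/
def p312 : Equiv.Perm (Fin 3) where
  toFun := ![2, 0, 1]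
  invFun := ![1, 2, 0]
  left_inv := by decide
  right_inv := by decide

/-- Set partitions of an `n`-element linearly ordered set of points. -/
abbrev SetPartition (n : ℕ) : Type := Finpartition (Finset.univ : Finset (Fin n))

/-- `(i, j)` is an arc of `P`: `i < j` are consecutive elements of a block of `P`. -/
def IsArc {n : ℕ} (P : SetPartition n) (i j : Fin n) : Prop :=
  ∃ B ∈ P.parts, i ∈ B ∧ j ∈ B ∧ i < j ∧ ∀ l ∈ B, ¬ (i < l ∧ l < j)

/-- `P` avoids `τ ∈ S_k`: there are no points `i_1 < ⋯ < i_{2k}` such that all the pairs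
`(i_a, i_{2k+1-τ(a)})`, `1 ≤ a ≤ k`, are arcs of `P`. With indices and values starting
at `0`, the index `2k+1-τ(a)` becomes `2k-1-τ(a)`. -/
def Avoids {n k : ℕ} (P : SetPartition n) (τ : Equiv.Perm (Fin k)) : Prop :=
  ¬ ∃ i : Fin (2 * k) → Fin n, StrictMono i ∧
    ∀ a : Fin k, IsArc P (i ⟨(a : ℕ), by omega⟩) (i ⟨2 * k - 1 - (τ a : ℕ), by omega⟩)

/-- A (perfect) matching is a set partition all of whose blocks have size `2`. -/
def IsMatching {n : ℕ} (P : SetPartition n) : Prop := ∀ B ∈ P.parts, B.card = 2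

/-- The number of set partitions of `[n]` that avoid every pattern in `S`. -/
def numPartitions {k : ℕ} (S : Set (Equiv.Perm (Fin k))) (n : ℕ) : ℕ :=
  {P : SetPartition n | ∀ τ ∈ S, Avoids P τ}.ncard

/-- The number of perfect matchings of `[2n]` that avoid every pattern in `S`. -/
def numMatchings {k : ℕ} (S : Set (Equiv.Perm (Fin k))) (n : ℕ) : ℕ :=
  {P : SetPartition (2 * n) | IsMatching P ∧ ∀ τ ∈ S, Avoids P τ}.ncard

/-- The ordinary generating function of the matchings that avoid every pattern in `S`. -/
def matchingGF {k : ℕ} (S : Set (Equiv.Perm (Fin k))) : ℚ⟦X⟧ :=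
  PowerSeries.mk fun n => (numMatchings S n : ℚ)

/-- The ordinary generating function of the partitions that avoid every pattern in `S`. -/
def partitionGF {k : ℕ} (S : Set (Equiv.Perm (Fin k))) : ℚ⟦X⟧ :=
  PowerSeries.mk fun n => (numPartitions S n : ℚ)

/-! ### Ferrers boards and full rook placements

A Ferrers board (French notation) is a finite lower set of `ℕ × ℕ`; the pair `(x, y)` stands
for the unit square `[x, x+1] × [y, y+1]`, in column `x` and row `y`. -/

/-- The unit squares inside the rectangle `[0, a] × [0, b]`. -/
def rect (a b : ℕ) : Finset (ℕ × ℕ) := Finset.range a ×ˢ Finset.range b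

/-- The lattice point `(a, b)` is on the border of `F`: the rectangle below and to the left
of it lies in `F`, and the square above and to the right of it does not. -/
def OnBorder (F : YoungDiagram) (a b : ℕ) : Prop :=
  rect a b ⊆ F.cells ∧ (a, b) ∉ F.cells

/-- `R` is a full rook placement on `F`: a set of squares of `F` with exactly one square in
each (nonempty) column and in each (nonempty) row of `F`. -/
def IsFullRookPlacement (F : YoungDiagram) (R : Finset (ℕ × ℕ)) : Prop :=
  R ⊆ F.cells ∧
    (∀ x, (x, 0) ∈ F.cells → ∃! y, (x, y) ∈ R) ∧
    (∀ y, (0, y) ∈ F.cells → ∃! x, (x, y) ∈ R)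

/-- The rooks in `T` contain `τ`: in some columns `c_1 < ⋯ < c_k` and rows `r_1 < ⋯ < r_k`,
all the squares `(c_a, r_{τ(a)})` are in `T`. -/
def RooksContain {k : ℕ} (T : Finset (ℕ × ℕ)) (τ : Equiv.Perm (Fin k)) : Prop :=
  ∃ c r : Fin k → ℕ, StrictMono c ∧ StrictMono r ∧ ∀ a, (c a, r (τ a)) ∈ T

/-- The placement `R` on `F` avoids `τ`: for each vertex `V = (a, b)` of the border of `F`, the
permutation given by the rooks in the rectangle `[0, a] × [0, b]` avoids `τ`. -/
def RookAvoids {k : ℕ} (F : YoungDiagram) (R : Finset (ℕ × ℕ)) (τ : Equiv.Perm (Fin k)) : Prop :=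
  ∀ a b, OnBorder F a b → ¬ RooksContain (R ∩ rect a b) τ

/-- The number of full rook placements on `F` that avoid every pattern in `S`. -/
def numPlacements {k : ℕ} (F : YoungDiagram) (S : Set (Equiv.Perm (Fin k))) : ℕ :=
  {R : Finset (ℕ × ℕ) | IsFullRookPlacement F R ∧ ∀ τ ∈ S, RookAvoids F R τ}.ncard

/-- Shape-Wilf-equivalence of two sets of patterns. -/
def ShapeWilfEquivalent {k : ℕ} (S T : Set (Equiv.Perm (Fin k))) : Prop :=
  ∀ F : YoungDiagram, numPlacements F S = numPlacements F T

/-! ### The Narayana generating function and the cubic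

Series in `v` and `z` are elements of `ℚ[v]⟦z⟧`. -/

/-- The number of valleys (a down step immediately followed by an up step) of a Dyck word. -/
def valleys (p : DyckWord) : ℕ :=
  (p.toList.zip p.toList.tail).count (DyckStep.D, DyckStep.U)

/-- `C(v, z) = ∑_n ∑_D v^{val(D)} z^n`, `D` ranging over the Dyck paths of semilength `n`. -/
def narayanaGF : ℚ[X]⟦X⟧ :=
  PowerSeries.mk fun n => ∑ p : {p : DyckWord // p.semilength = n}, Polynomial.X ^ valleys p.1

/-- `H` is a root of the cubic `α H³ + β H² + γ H + δ`. -/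
def IsCubicRoot (H : ℚ[X]⟦X⟧) : Prop :=
  let v : ℚ[X]⟦X⟧ := PowerSeries.C Polynomial.X
  let z : ℚ[X]⟦X⟧ := PowerSeries.X
  let C : ℚ[X]⟦X⟧ := narayanaGF
  let α := v ^ 2 * z ^ 2
  let β := -2 * v * z + 2 * v * (1 - v) * z ^ 2 + v ^ 2 * z ^ 2 * C
  let γ := 1 - 2 * (1 - v) * z + (1 - v) ^ 2 * z ^ 2 - v * z * C
  let δ := -1 + (v * z - (1 - v) ^ 2 * z ^ 2) * C
  α * H ^ 3 + β * H ^ 2 + γ * H + δ = 0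

/-- The specialization `H(1, z)`. -/
def atOne (H : ℚ[X]⟦X⟧) : ℚ⟦X⟧ := PowerSeries.map (Polynomial.evalRingHom 1) H

/-- The term `h_n(1/z) (z²/(1-z)²)^n`, a Laurent series in `z`, where
`H(v, z) = ∑_n h_n(v) z^n`. -/
def substTerm (H : ℚ[X]⟦X⟧) (n : ℕ) : ℚ⸨X⸩ :=
  let z : ℚ⸨X⸩ := HahnSeries.single 1 1
  Polynomial.aeval z⁻¹ (PowerSeries.coeff n H) * (z ^ 2 / (1 - z) ^ 2) ^ n

/-- `G(z) = H(1/z, z²/(1-z)²)`: for each `m`, only finitely many of the terms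
`h_n(1/z) (z²/(1-z)²)^n` have a nonzero coefficient of `z^m`, and these coefficients add up to
the coefficient of `z^m` in `G`. -/
def IsSubst (H : ℚ[X]⟦X⟧) (G : ℚ⟦X⟧) : Prop :=
  ∀ m : ℤ, {n : ℕ | (substTerm H n).coeff m ≠ 0}.Finite ∧
    (HahnSeries.ofPowerSeries ℤ ℚ G).coeff m = ∑ᶠ n : ℕ, (substTerm H n).coeff m

end ArcPatterns

end

open ArcPatterns

noncomputable section

namespace ArcPatterns

/-! Read the points of a partition from left to right and keep the set `L` of open arcs. When the
point `t` closes the arc opened at `j`, it is the earliest remaining closer, so in an occurrence of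
`123` or `231` the arc `(j, t)` can only be the one with the smallest closer. Avoiding such
occurrences means: the open arcs below `j` must close in increasing order (`123`), and every open
arc above `j` must close before every one below `j` (`231`). This is `avoids_insert_iff`. Points
opened later are unconstrained.

Hence a state is given by three numbers: `a` chained arcs, `b` arcs to be closed before them, `f`
free arcs. If `a = 0` or `b = 0`, either the first chained arc or any arc above the chain may be
closed. If both are positive, only the lowest of the `b` arcs may be closed: a chained arc has to
wait, and closing anything higher would force the chain both before and after that lowest arc. In
each case only `a` and `b + f` matter, which gives the tables `S₁` and `S₂` and the equations
`IsTransferSolution`. Any solution of these equations counts the completions, by induction on the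
number of remaining points (`countedBy`), so it suffices to exhibit one.

Let `x` mark points, `c = 1` for partitions and `c = 0` for matchings, `y = 1/(1 - c x)`, `z = (x
y)²`, `e = c x y`. Up to powers of `x y`, the table `S₂` is geometric, `C B^(m-1) d a`. The ansatz
`U a f = u (a + f) - C W (a + 1) f` turns the equations for `S₁` into a linear recurrence in one
index. It contains a term multiplied by `z`, and instead of dividing by `z` one looks for a solution
satisfying a recurrence of lower order; the consistency condition for the coefficient `p = (H -
1)/(z H)` is the cubic for `H`. The boundary conditions at `a = 0` then give `U 0 0 = 1 + z H / (1 -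
(z + e) H)`. Matchings have `e = 0`, that is `v = 1`; for partitions `v = (z + e)/z = 1/x`.

The cubic is a polynomial in `z`, `v z`, `C` and `H`, and has derivative `1` modulo `z`. So it has
exactly one root, and the coefficient of `zⁿ` in it has degree at most `n` in `v`, which makes the
substitution converge.

Reflecting the points replaces each pattern by its inverse and exchanges `231` with `312`. On
boards, inversion also transposes the board, so a board that separates the two pairs cannot be
self-conjugate; a finite check settles the one with columns `5, 5, 5, 4, 4`. -/

/-! ### Solving the transfer equations -/

/-- The algebraic data from which the solution of the transfer equations is built: the two
Narayana series `C`, `B`, the root `H` of the cubic and the auxiliary series `p = (H - 1) / (z H)`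
and `s = 1 / (1 - (z + e) H)`. -/
structure KernelData (R : Type*) [CommRing R] where
  (z e C B H p s : R)
  hC : C = 1 + z * C * B
  hB : B = 1 + (z + e) * C * B
  hs : s * (1 - (z + e) * H) = 1
  eq_p : (1 - e - z * p) * p - (1 + z * B * (C - H) * (1 + e * p)) * (1 + e * p) = 1
  hp : z * H * p = H - 1

namespace KernelData

variable {R : Type*} [CommRing R] (K : KernelData R)

/-- The pairs `(ξ k, m k)`, a vector-valued linear recurrence. -/
def vec : ℕ → R × R
  | 0 => (K.s * (1 - (K.z + K.e) * K.C), K.s * K.e * (K.C - K.H))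
  | k + 1 =>
    (K.e * K.B * (K.C - K.H) * (1 + K.e * K.p) * (vec k).1 - (1 + K.e * K.p) * (vec k).2,
      K.p * (vec k).2 + K.B * (K.C - (K.C - K.H) * (1 + K.e * K.p)) * (vec k).1)

def xi (k : ℕ) : R := (K.vec k).1

/-- The second entry of `vec (k + 1)` is `U k 1`; the recurrence of `vec` expresses it through the
entries of `vec k`. -/
def u (k : ℕ) : R := (K.vec k).2 + K.C * K.xi k

/-- This is the value `V k 0` of a state with `k` chained and no free arcs. Its form as a difference
makes the sums over the closed arc telescope. -/
def d (k : ℕ) : R := K.B * K.xi k - K.xi (k + 1)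

/-- Explicitly, `W a f` is the sum of `B ^ (f - 1 - i) * xi (a + i)` over `i < f`. -/
def W (a : ℕ) : ℕ → R
  | 0 => 0
  | f + 1 => K.B * W a f + K.xi (a + f)

/-- Generating function of the completions of the state with `a` chained and `f` free arcs,
after an up step. -/
def U (a f : ℕ) : R := K.u (a + f) - K.C * K.W (a + 1) f

/-- The same after a down step. -/
def V (a f : ℕ) : R := K.d (a + f) - K.B * K.W (a + 1) f

lemma B_sub_C : K.B - K.C = K.e * K.B * K.C := by linear_combination K.hB - K.hC

lemma B_mul : K.B * (1 - (K.z + K.e) * K.C) = 1 := by linear_combination K.hB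

lemma C_mul : K.C * (1 - K.z * K.B) = 1 := by linear_combination K.hC

lemma W_succ' (a f : ℕ) : K.W a (f + 1) = K.B ^ f * K.xi a + K.W (a + 1) f := by
  induction f with
  | zero => simp [W]
  | succ f ih =>
    rw [W, ih, W, show a + 1 + f = a + (f + 1) by ring]
    ring

/-- After `vec` is unfolded in `u_succ`, `eq_p` is the identity needed for the second entry of `vec
k` and `eq_r` the one for the first. The latter follows from the former. -/
lemma eq_r : (1 - K.e - K.z * K.p) * (K.B * (K.C - (K.C - K.H) * (1 + K.e * K.p))) +
    (1 + K.z * K.B * (K.C - K.H) * (1 + K.e * K.p)) *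
      (K.e * K.B * (K.C - K.H) * (1 + K.e * K.p)) = K.C := by
  linear_combination -K.B * (K.C - K.H) * K.e * K.eq_p - K.B * K.hp + K.B_sub_C

lemma d_eq (k : ℕ) : K.d k = K.u k + K.e * (K.u (k + 1) - K.C * K.xi (k + 1)) := by
  simp only [d, u, xi, vec]
  linear_combination (K.vec k).1 * K.B_sub_C

/-- The case `f = 0` of `U_succ`. This is the relation with the factor `z` in front of the highest
index, and the place where the cubic is used, through `eq_p` and `eq_r`. -/
lemma u_succ (k : ℕ) :
    K.u (k + 1) = K.z * (K.u (k + 2) - K.C * K.xi (k + 2)) + K.d k := by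
  rw [d_eq]
  simp only [u, xi, vec]
  generalize (K.vec k).1 = x
  generalize (K.vec k).2 = m
  linear_combination m * K.eq_p + x * K.eq_r + (K.e * K.B * (K.C - K.H) * (1 + K.e * K.p) * x
    - (1 + K.e * K.p) * m) * K.C_mul

/-- The direction of the initial vector is chosen for this boundary condition, required by the
equations with `a = 0`; the factor `s` then normalizes `U 0 0 = 1 + z * U 0 1`. -/
lemma xi_one : K.xi 1 = 0 := by
  simp only [xi, vec]
  linear_combination K.s * K.e * (K.C - K.H) * (1 + K.e * K.p) * K.B_mul

lemma u_one : K.u 1 = K.s * K.H := by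
  have h := K.xi_one
  rw [u, h]
  simp only [vec]
  linear_combination K.s * (K.C - (K.C - K.H) * (1 + K.e * K.p)) * K.B_mul

lemma u_zero : K.u 0 = 1 + K.z * K.s * K.H := by
  simp only [u, xi, vec]
  have h := K.B_mul
  have h1 : K.e * K.C + K.C - (K.z + K.e) * K.C ^ 2 = 1 := by
    have h2 : K.C * (1 - (K.z + K.e) * K.C) = 1 - K.e * K.C := by
      linear_combination (1 - (K.z + K.e) * K.C) * K.hC + (K.z * K.C) * h
    linear_combination h2
  linear_combination K.s * h1 + K.hs

lemma U_zero_zero : K.U 0 0 = 1 + K.z * K.U 0 1 := by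
  simp only [U, W, zero_add, add_zero, u_zero, u_one, xi_one]
  ring

lemma V_eq (a f : ℕ) : K.V a f = K.U a f + K.e * K.U a (f + 1) := by
  simp only [V, U, W, d_eq, show a + 1 + f = a + f + 1 by ring, show a + (f + 1) = a + f + 1 by ring]
  linear_combination (-K.W (a + 1) f) * K.B_sub_C

lemma sum_d (a f : ℕ) :
    ∑ k ∈ Finset.Ico a (a + f), K.B ^ (a + f - 1 - k) * K.d k =
      K.B ^ f * K.xi a - K.xi (a + f) := by
  induction f with
  | zero => simp
  | succ f ih =>
    rw [← add_assoc, Finset.sum_Ico_succ_top (by omega)]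
    have : ∑ k ∈ Finset.Ico a (a + f), K.B ^ (a + f + 1 - 1 - k) * K.d k =
        K.B * ∑ k ∈ Finset.Ico a (a + f), K.B ^ (a + f - 1 - k) * K.d k := by
      rw [Finset.mul_sum]
      refine Finset.sum_congr rfl fun k hk => ?_
      rw [Finset.mem_Ico] at hk
      rw [show a + f + 1 - 1 - k = (a + f - 1 - k) + 1 by omega]
      ring
    rw [this, ih, show a + f + 1 - 1 - (a + f) = 0 by omega, d]
    ring

lemma U_succ (a f : ℕ) : K.U (a + 1) f = K.z * K.U (a + 1) (f + 1) + K.V a f +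
    ∑ k ∈ Finset.Ico (a + 1) (a + 1 + f), K.B ^ (a + 1 + f - 1 - k) * K.d k := by
  have h1 := K.W_succ' (a + 1) f
  rw [W] at h1
  have h2 := K.u_succ (a + f)
  rw [sum_d]
  simp only [U, V, W, show a + 1 + f = a + f + 1 by ring, show a + 1 + (f + 1) = a + f + 2 by ring,
    show a + 1 + 1 + f = a + f + 2 by ring] at *
  linear_combination h2 - (K.W (a + 1 + 1) f) * K.hC + h1

/-- With no chain, closing the lowest free arc leads to `V 0 f`, and the sum starts at `k = 1`. It
telescopes to `-xi (f + 1)` because `xi 1 = 0`. -/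
lemma U_zero_succ (f : ℕ) : K.U 0 (f + 1) = K.z * K.U 0 (f + 2) + K.V 0 f +
    ∑ k ∈ Finset.Ico 1 (f + 1), K.B ^ (f - k) * K.d k := by
  have h3 := K.sum_d 1 f
  have h2 := K.u_succ f
  simp only [show 1 + f = f + 1 by ring, show f + 1 - 1 = f by omega, xi_one] at h3
  rw [h3]
  have h4 : K.W 1 (f + 1) = K.B * K.W 1 f + K.xi (f + 1) := by rw [W, add_comm 1 f]
  have h5 : K.W 1 (f + 2) = K.B * K.W 1 (f + 1) + K.xi (f + 2) := by
    rw [W, show 1 + (f + 1) = f + 2 by ring]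
  simp only [U, V, zero_add]
  rw [h5]
  linear_combination h2 - (K.W 1 (f + 1)) * K.hC - h4

lemma V_zero (a : ℕ) : K.V a 0 = K.d a := by simp [V, W]

/-- The analogue of `U` for the states in which `m ≥ 1` arcs have to be closed before the chain
of `a` arcs. -/
def U₂ (a m : ℕ) : R := K.C * K.B ^ (m - 1) * K.d a

lemma U₂_one (a : ℕ) : K.U₂ a 1 = K.z * K.U₂ a 2 + K.d a := by
  simp only [U₂, Nat.sub_self]
  linear_combination K.d a * K.hC

lemma U₂_add (a m : ℕ) (hm : 1 ≤ m) : K.U₂ a m + K.e * K.U₂ a (m + 1) = K.B ^ m * K.d a := by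
  obtain ⟨m, rfl⟩ := Nat.exists_eq_add_of_le' hm
  simp only [U₂, Nat.add_sub_cancel]
  linear_combination (-K.B ^ m * K.d a) * K.B_sub_C

lemma U₂_succ (a m : ℕ) (hm : 1 ≤ m) :
    K.U₂ a (m + 1) = K.z * K.U₂ a (m + 2) + K.B ^ m * K.d a := by
  simp only [U₂, Nat.add_sub_cancel, show m + 2 - 1 = m + 1 by omega]
  linear_combination (K.B ^ m * K.d a) * K.hC

end KernelData

/-- `KernelData` from a root of the cubic. -/
lemma exists_kernelData (z w C H : ℚ⟦X⟧) (hz0 : z ≠ 0)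
    (hz : PowerSeries.constantCoeff z = 0) (hw : PowerSeries.constantCoeff w = 0)
    (hH : PowerSeries.constantCoeff H = 1)
    (hC : C = 1 + z * C + w * C * (C - 1))
    (hcub : w ^ 2 * H ^ 3 + (-2 * w + 2 * w * (z - w) + w ^ 2 * C) * H ^ 2 +
      (1 - 2 * (z - w) + (z - w) ^ 2 - w * C) * H + (-1 + w * C - (z - w) ^ 2 * C) = 0) :
    ∃ K : KernelData ℚ⟦X⟧, K.z = z ∧ K.e = w - z ∧ K.H = H := by
  have hu : ∀ f : ℚ⟦X⟧, PowerSeries.constantCoeff f = 1 → ∃ g, g * f = 1 := fun f hf =>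
    ⟨f⁻¹, PowerSeries.inv_mul_cancel f (by rw [hf]; exact one_ne_zero)⟩
  obtain ⟨B, hB⟩ := hu (1 - w * C) (by simp [hw])
  obtain ⟨s, hs⟩ := hu (1 - w * H) (by simp [hw])
  obtain ⟨h, hh⟩ := hu H hH
  -- `f(H) - f(1) = (H - 1) g`
  obtain ⟨g, hg⟩ := hu (w ^ 2 * (H ^ 2 + H + 1) +
      (-2 * w + 2 * w * (z - w) + w ^ 2 * C) * (H + 1) +
      (1 - 2 * (z - w) + (z - w) ^ 2 - w * C)) (by simp [hw, hz])
  -- The value of the cubic at `1` is `-z (2 - z - C (2 w - z))`, so `H - 1` is `z` times this last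
  -- factor times `g`, the inverse of the difference quotient. Hence `p = (H - 1) / (z H)` is a
  -- power series.
  have hp : z * H * (h * g * (2 - z - C * (2 * w - z))) = H - 1 := by
    linear_combination (z * g * (2 - z - C * (2 * w - z))) * hh - g * hcub + (H - 1) * hg
  have hC0 : PowerSeries.constantCoeff C = 1 := by
    rw [hC]; simp [hz, hw]
  have hBC : C = 1 + z * C * B := by
    linear_combination (C - 1) * (-hB) + B * hC
  generalize h * g * (2 - z - C * (2 * w - z)) = p at hp
  refine ⟨⟨z, w - z, C, B, H, p, s, hBC, by linear_combination hB, by linear_combination hs,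
    ?_, hp⟩, rfl, rfl, rfl⟩
  -- Multiplied by this nonzero factor, the difference of the two sides of `eq_p` no longer involves
  -- `p` or `B` and becomes minus the cubic.
  have h1 : z * H ^ 2 * (1 - w * C) ≠ 0 := by
    refine mul_ne_zero (mul_ne_zero hz0 (pow_ne_zero _ ?_)) ?_
    · rintro rfl; simp at hH
    · intro h0; rw [h0] at hB; simp at hB
  refine mul_left_cancel₀ h1 ?_
  have h2 : z * H ^ 2 * ((1 - (w - z) - z * p) * p -
      (1 + z * B * (C - H) * (1 + (w - z) * p)) * (1 + (w - z) * p) - 1) =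
      -1 + (1 + 2 * (w - z)) * H - 2 * w * H ^ 2 - B * (C - H) * (w * H - (w - z)) ^ 2 := by
    linear_combination (H * (1 - (w - z)) - (z * H * p + H - 1) - (w - z) * H - B * (C - H) *
      (w - z) * (2 * z * H + (w - z) * (z * H * p + H - 1))) * hp
  linear_combination (1 - w * C) * h2 + hcub - (C - H) * (w * H - (w - z)) ^ 2 * hB

/-- The state `(a, b, f)`: `a` chained arcs, `b` arcs that have to be closed before these, and `f`
free arcs. Its value is read off from the two tables `S₁` and `S₂`. -/
def stateValue {R : Type*} (S₁ S₂ : ℕ → ℕ → R) (a b f : ℕ) : R :=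
  if a = 0 ∨ b = 0 then S₁ a (b + f) else S₂ a (b + f)

/-- The equations for the generating functions of the completions of the states. -/
structure IsTransferSolution (c : ℚ) (S₁ S₂ : ℕ → ℕ → ℚ⟦X⟧) : Prop where
  eq₁ : ∀ a f, S₁ a f = (if a = 0 ∧ f = 0 then 1 else 0) + PowerSeries.X *
    (PowerSeries.C c * S₁ a f + S₁ a (f + 1) +
      (if a = 0 then 0 else S₁ (a - 1) f + PowerSeries.C c * S₁ (a - 1) (f + 1)) +
      ∑ k ∈ Finset.Ico a (a + f), (stateValue S₁ S₂ k (a + f - 1 - k) 0 +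
        PowerSeries.C c * stateValue S₁ S₂ k (a + f - 1 - k) 1))
  eq₂ : ∀ a m, 1 ≤ a → 1 ≤ m → S₂ a m = PowerSeries.X *
    (PowerSeries.C c * S₂ a m + S₂ a (m + 1) + (stateValue S₁ S₂ a (m - 1) 0 +
        PowerSeries.C c * stateValue S₁ S₂ a (m - 1) 1))

/-- The factor `y` accounts for singletons, and each open arc carries a factor `x y` for its closer.
An opener costs `x y` and adds an open arc, so it contributes `(x y)² = z`; a pure closer
contributes `1`; a closer that is also an opener contributes `e`. -/
lemma KernelData.isTransferSolution (K : KernelData ℚ⟦X⟧) (c : ℚ) (y : ℚ⟦X⟧)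
    (hy : y * (1 - PowerSeries.C c * PowerSeries.X) = 1)
    (hz : K.z = (PowerSeries.X * y) ^ 2) (he : K.e = PowerSeries.C c * (PowerSeries.X * y)) :
    IsTransferSolution c (fun a f => (PowerSeries.X * y) ^ (a + f) * y * K.U a f)
      (fun a m => (PowerSeries.X * y) ^ (a + m) * y * K.U₂ a m) := by
  set x : ℚ⟦X⟧ := PowerSeries.X with hx
  set t : ℚ⟦X⟧ := PowerSeries.C c with ht
  set S₁ : ℕ → ℕ → ℚ⟦X⟧ := fun a f => (x * y) ^ (a + f) * y * K.U a f with hS₁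
  set S₂ : ℕ → ℕ → ℚ⟦X⟧ := fun a m => (x * y) ^ (a + m) * y * K.U₂ a m with hS₂
  have hV : ∀ a f, S₁ a f + t * S₁ a (f + 1) = (x * y) ^ (a + f) * y * K.V a f := by
    intro a f
    simp only [hS₁, K.V_eq, he, ← add_assoc]
    ring
  -- For `k ≥ 1` the values read from `S₁` (when `q = 0`) and from `S₂` (when `q ≥ 1`) obey one
  -- formula.
  have hd : ∀ k q, 1 ≤ k → stateValue S₁ S₂ k q 0 + t * stateValue S₁ S₂ k q 1 =
      (x * y) ^ (k + q) * y * (K.B ^ q * K.d k) := by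
    intro k q hk
    rcases Nat.eq_zero_or_pos q with rfl | hq
    · simp only [stateValue, or_true, if_true, add_zero, zero_add]
      have := hV k 0
      simp only [zero_add, add_zero] at this
      rw [this, K.V_zero]; simp
    · rw [stateValue, stateValue, if_neg (by omega), if_neg (by omega), add_zero,
        ← K.U₂_add k q hq, he]
      simp only [hS₂, ← add_assoc]
      ring
  have hsum : ∀ a f, 1 ≤ a → ∑ k ∈ Finset.Ico a (a + f),
      (stateValue S₁ S₂ k (a + f - 1 - k) 0 + t * stateValue S₁ S₂ k (a + f - 1 - k) 1) =
      (x * y) ^ (a + f - 1) * y *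
        ∑ k ∈ Finset.Ico a (a + f), K.B ^ (a + f - 1 - k) * K.d k := by
    intro a f ha
    rw [Finset.mul_sum]
    refine Finset.sum_congr rfl fun k hk => ?_
    rw [Finset.mem_Ico] at hk
    rw [hd _ _ (by omega), show k + (a + f - 1 - k) = a + f - 1 by omega]
  constructor
  · rintro (_ | a) f
    · rcases f with _ | f
      · have := K.U_zero_zero
        rw [hz] at this
        simp only [hS₁, add_zero, zero_add, pow_zero, pow_one, one_mul, and_self, if_true,
          Finset.Ico_self, Finset.sum_empty]
        linear_combination this + K.U 0 0 * hy
      · have h := K.U_zero_succ f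
        rw [hz] at h
        -- The term `k = 0` is split off: closing the lowest arc leaves no chain, so its value comes
        -- from `S₁` for every `f`.
        have h0 := Finset.sum_eq_sum_Ico_succ_bot (show 0 < 0 + (f + 1) by omega) fun k =>
          stateValue S₁ S₂ k (0 + (f + 1) - 1 - k) 0 + t * stateValue S₁ S₂ k (0 + (f + 1) - 1 - k) 1
        have h1 := hsum 1 f le_rfl
        simp only [show 1 + f = f + 1 by ring, show f + 1 - 1 = f by omega] at h1
        simp only [zero_add, Nat.add_sub_cancel] at h0
        have h2 : stateValue S₁ S₂ 0 (f - 0) 0 + t * stateValue S₁ S₂ 0 (f - 0) 1 =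
            (x * y) ^ f * y * K.V 0 f := by
          have := hV 0 f
          rw [zero_add] at this
          simpa only [stateValue, true_or, if_true, Nat.sub_zero, add_zero] using this
        simp only [zero_add, Nat.add_sub_cancel, if_true, ← hx, ← ht]
        rw [if_neg (by omega), zero_add, h0, h2, h1]
        simp only [hS₁, zero_add]
        linear_combination ((x * y) ^ (f + 1)) * h + (x * y) ^ (f + 1) * K.U 0 (f + 1) * hy
    · have h := K.U_succ a f
      rw [hz] at h
      have h1 := hsum (a + 1) f (by omega)
      simp only [← hx, ← ht]
      rw [if_neg (by omega), if_neg (by omega), h1, Nat.add_sub_cancel, hV,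
        show a + 1 + f - 1 = a + f by omega] at *
      simp only [hS₁]
      rw [show a + 1 + f = a + f + 1 by ring, show a + 1 + (f + 1) = a + f + 2 by ring] at *
      linear_combination (x * y) ^ (a + f + 1) * h + (x * y) ^ (a + f + 1) * K.U (a + 1) f * hy
  · intro a m ha hm
    obtain ⟨m, rfl⟩ := Nat.exists_eq_add_of_le' hm
    simp only [← hx, ← ht]
    rw [Nat.add_sub_cancel, hd a m ha]
    have h : K.U₂ a (m + 1) = K.z * K.U₂ a (m + 2) + K.B ^ m * K.d a := by
      rcases Nat.eq_zero_or_pos m with rfl | h0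
      · simpa using K.U₂_one a
      · exact K.U₂_succ a m h0
    rw [hz] at h
    simp only [hS₂, ← add_assoc]
    linear_combination (x * y) ^ (a + m + 1) * h + (x * y) ^ (a + m + 1) * K.U₂ a (m + 1) * hy

section Completions

/-! ### Systems of arcs with dangling openers -/

/-- `A` is a set of arcs on the points `t, …, N - 1` together with the points of `L`, each of which
is the opener of an arc. If `b` holds, then each of `t, …, N - 1` is either an opener or a closer,
but not both. -/
structure IsOpenSystem (b : Bool) (N t : ℕ) (L : Finset ℕ) (A : Finset (ℕ × ℕ)) : Prop where
  src : ∀ i j, (i, j) ∈ A → i ∈ L ∨ t ≤ i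
  lt : ∀ i j, (i, j) ∈ A → i < j
  ge : ∀ i j, (i, j) ∈ A → t ≤ j
  bd : ∀ i j, (i, j) ∈ A → j < N
  out : ∀ i j k, (i, j) ∈ A → (i, k) ∈ A → j = k
  inn : ∀ i j k, (i, k) ∈ A → (j, k) ∈ A → i = j
  dang : ∀ i ∈ L, ∃ j, (i, j) ∈ A
  perf : b = true → ∀ p, t ≤ p → p < N → ¬ ((∃ j, (p, j) ∈ A) ↔ (∃ i, (i, p) ∈ A))

/-- `A` avoids the patterns `123` and `231`. -/
structure AvoidsBoth (A : Finset (ℕ × ℕ)) : Prop where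
  nest : ∀ i₁ i₂ i₃ j₁ j₂ j₃, i₁ < i₂ → i₂ < i₃ → i₃ < j₁ → j₁ < j₂ → j₂ < j₃ →
    (i₁, j₃) ∈ A → (i₂, j₂) ∈ A → (i₃, j₁) ∈ A → False
  p231 : ∀ i₁ i₂ i₃ j₁ j₂ j₃, i₁ < i₂ → i₂ < i₃ → i₃ < j₁ → j₁ < j₂ → j₂ < j₃ →
    (i₁, j₂) ∈ A → (i₂, j₁) ∈ A → (i₃, j₃) ∈ A → False

/-- The openers in `L` below `c` are closed in increasing order, and after those between `c`
and `d`. -/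
structure IsChained (L : Finset ℕ) (c d : ℕ) (A : Finset (ℕ × ℕ)) : Prop where
  inc : ∀ x y j k, x ∈ L → y ∈ L → x < y → y < c → (x, j) ∈ A → (y, k) ∈ A → j < k
  dec : ∀ x y j k, x ∈ L → y ∈ L → x < c → c ≤ y → y < d → (x, j) ∈ A → (y, k) ∈ A → k < j

open Classical in
/-- The completions of a state. -/
def completions (b : Bool) (N t : ℕ) (L : Finset ℕ) (c d : ℕ) : Finset (Finset (ℕ × ℕ)) :=
  (Finset.range N ×ˢ Finset.range N).powerset.filter fun A =>
    IsOpenSystem b N t L A ∧ AvoidsBoth A ∧ IsChained L c d A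

variable {b : Bool} {N t : ℕ} {L : Finset ℕ} {c d : ℕ} {A : Finset (ℕ × ℕ)}

lemma mem_completions : A ∈ completions b N t L c d ↔
    IsOpenSystem b N t L A ∧ AvoidsBoth A ∧ IsChained L c d A := by
  classical
  simp only [completions, Finset.mem_filter]
  rw [and_iff_right_of_imp]
  rintro ⟨h, -⟩
  rw [Finset.mem_powerset]
  rintro ⟨i, j⟩ hij
  have := h.lt i j hij
  have := h.bd i j hij
  simp only [Finset.mem_product, Finset.mem_range]
  omega

/-- A point opened at `t` lies above both thresholds, so a new arc is always free. -/
lemma isChained_insert (hc : c ≤ t) (hd : d ≤ t) :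
    IsChained (insert t L) c d A ↔ IsChained L c d A := by
  constructor
  · rintro ⟨h1, h2⟩
    exact ⟨fun x y j k hx hy => h1 x y j k (Finset.mem_insert_of_mem hx)
      (Finset.mem_insert_of_mem hy), fun x y j k hx hy => h2 x y j k (Finset.mem_insert_of_mem hx)
      (Finset.mem_insert_of_mem hy)⟩
  · rintro ⟨h1, h2⟩
    constructor
    · intro x y j k hx hy hxy hyc
      exact h1 x y j k (Finset.mem_of_mem_insert_of_ne hx (by omega))
        (Finset.mem_of_mem_insert_of_ne hy (by omega)) hxy hyc
    · intro x y j k hx hy hxc hcy hyd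
      exact h2 x y j k (Finset.mem_of_mem_insert_of_ne hx (by omega))
        (Finset.mem_of_mem_insert_of_ne hy (by omega)) hxc hcy hyd

lemma completions_self (hL : ∀ x ∈ L, x < N) :
    (completions b N N L c d).card = if L = ∅ then 1 else 0 := by
  have h0 : ∀ A, IsOpenSystem b N N L A → A = ∅ := fun A h => by
    rw [Finset.eq_empty_iff_forall_notMem]
    rintro ⟨i, j⟩ hij
    have := h.ge i j hij
    have := h.bd i j hij
    omega
  split_ifs with h
  · subst h
    rw [Finset.card_eq_one]
    refine ⟨∅, Finset.eq_singleton_iff_unique_mem.2 ⟨mem_completions.2 ⟨?_, ?_, ?_⟩, fun A hA =>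
      h0 A (mem_completions.1 hA).1⟩⟩
    · constructor <;> simp
    · constructor <;> simp
    · constructor <;> simp
  · rw [Finset.card_eq_zero, Finset.eq_empty_iff_forall_notMem]
    intro A hA
    obtain ⟨x, hx⟩ := Finset.nonempty_iff_ne_empty.2 h
    obtain ⟨j, hj⟩ := (mem_completions.1 hA).1.dang x hx
    rw [h0 A (mem_completions.1 hA).1] at hj
    simp at hj

/-- The point `t` is an opener and not a closer. -/
lemma isOpenSystem_insert_iff (hL : ∀ x ∈ L, x < t) (ht : t < N) :
    IsOpenSystem b N (t + 1) (insert t L) A ↔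
      IsOpenSystem b N t L A ∧ (¬ ∃ i, (i, t) ∈ A) ∧ ∃ j, (t, j) ∈ A := by
  constructor
  · intro h
    have h1 : ∃ j, (t, j) ∈ A := h.dang t (Finset.mem_insert_self _ _)
    have h2 : ¬ ∃ i, (i, t) ∈ A := by
      rintro ⟨i, hi⟩
      have := h.ge i t hi
      omega
    refine ⟨⟨?_, h.lt, ?_, h.bd, h.out, h.inn, ?_, ?_⟩, h2, h1⟩
    · intro i j hij
      rcases h.src i j hij with h3 | h3
      · rcases Finset.mem_insert.1 h3 with rfl | h3
        · exact Or.inr le_rfl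
        · exact Or.inl h3
      · exact Or.inr (by omega)
    · intro i j hij
      have := h.ge i j hij
      omega
    · exact fun i hi => h.dang i (Finset.mem_insert_of_mem hi)
    · intro hb p hp hpN
      rcases eq_or_lt_of_le hp with rfl | hp
      · tauto
      · exact h.perf hb p hp hpN
  · rintro ⟨h, h2, h1⟩
    refine ⟨?_, h.lt, ?_, h.bd, h.out, h.inn, ?_, ?_⟩
    · intro i j hij
      rcases h.src i j hij with h3 | h3
      · exact Or.inl (Finset.mem_insert_of_mem h3)
      · rcases eq_or_lt_of_le h3 with rfl | h3
        · exact Or.inl (Finset.mem_insert_self _ _)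
        · exact Or.inr h3
    · intro i j hij
      rcases eq_or_lt_of_le (h.ge i j hij) with rfl | h3
      · exact absurd ⟨i, hij⟩ h2
      · exact h3
    · intro i hi
      rcases Finset.mem_insert.1 hi with rfl | hi
      · exact h1
      · exact h.dang i hi
    · exact fun hb p hp hpN => h.perf hb p (by omega) hpN

/-- The point `t` is a singleton. -/
lemma isOpenSystem_succ_iff (hL : ∀ x ∈ L, x < t) (ht : t < N) :
    (b = false ∧ IsOpenSystem b N (t + 1) L A) ↔
      IsOpenSystem b N t L A ∧ (¬ ∃ i, (i, t) ∈ A) ∧ ¬ ∃ j, (t, j) ∈ A := by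
  constructor
  · rintro ⟨rfl, h⟩
    refine ⟨⟨?_, h.lt, ?_, h.bd, h.out, h.inn, h.dang, by simp⟩, ?_, ?_⟩
    · intro i j hij
      exact (h.src i j hij).imp_right fun h => by omega
    · intro i j hij
      have := h.ge i j hij
      omega
    · rintro ⟨i, hi⟩
      have := h.ge i t hi
      omega
    · rintro ⟨j, hj⟩
      rcases h.src t j hj with h1 | h1
      · exact (hL t h1).false
      · omega
  · rintro ⟨h, h1, h2⟩
    refine ⟨?_, ?_, h.lt, ?_, h.bd, h.out, h.inn, h.dang, ?_⟩
    · by_contra hb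
      rw [Bool.not_eq_false] at hb
      have := h.perf hb t le_rfl ht
      tauto
    · intro i j hij
      rcases h.src i j hij with h3 | h3
      · exact Or.inl h3
      · rcases eq_or_lt_of_le h3 with rfl | h3
        · exact absurd ⟨j, hij⟩ h2
        · exact Or.inr h3
    · intro i j hij
      rcases eq_or_lt_of_le (h.ge i j hij) with rfl | h3
      · exact absurd ⟨i, hij⟩ h1
      · exact h3
    · exact fun hb p hp hpN => h.perf hb p (by omega) hpN

/-- The completions in which the first point `t` closes the arc opened at `j`. -/
def closing (b : Bool) (N t : ℕ) (L : Finset ℕ) (c d j : ℕ) : Finset (Finset (ℕ × ℕ)) :=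
  (completions b N t L c d).filter fun A => (j, t) ∈ A

lemma card_completions (hL : ∀ x ∈ L, x < t) (ht : t < N) (hc : c ≤ t) (hd : d ≤ t) :
    (completions b N t L c d).card = (if b then 0 else (completions b N (t + 1) L c d).card) +
      (completions b N (t + 1) (insert t L) c d).card +
      ∑ j ∈ L, (closing b N t L c d j).card := by
  classical
  rw [← Finset.card_filter_add_card_filter_not (s := completions b N t L c d)
    (fun A => ∃ i, (i, t) ∈ A), add_comm]
  congr 1
  · rw [← Finset.card_filter_add_card_filter_not
      (s := (completions b N t L c d).filter fun A => ¬ ∃ i, (i, t) ∈ A)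
      (fun A => ∃ j, (t, j) ∈ A), add_comm]
    congr 1
    · have : ((completions b N t L c d).filter fun A => ¬ ∃ i, (i, t) ∈ A).filter
          (fun A => ¬ ∃ j, (t, j) ∈ A) = if b then ∅ else completions b N (t + 1) L c d := by
        ext A
        rw [Finset.mem_filter, Finset.mem_filter, mem_completions]
        have h := isOpenSystem_succ_iff (b := b) (A := A) hL ht
        cases b
        · simp only [Bool.false_eq_true, if_false, mem_completions]
          tauto
        · simp only [if_true, Finset.notMem_empty]
          tauto
      rw [this]
      split_ifs <;> simp
    · congr 1
      ext A
      rw [Finset.mem_filter, Finset.mem_filter, mem_completions, mem_completions,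
        isOpenSystem_insert_iff hL ht, isChained_insert hc hd]
      tauto
  · rw [← Finset.card_biUnion]
    · congr 1
      ext A
      simp only [Finset.mem_filter, Finset.mem_biUnion, closing]
      constructor
      · rintro ⟨h, i, hi⟩
        have h1 := (mem_completions.1 h).1
        refine ⟨i, ?_, h, hi⟩
        rcases h1.src i t hi with h2 | h2
        · exact h2
        · have := h1.lt i t hi
          omega
      · rintro ⟨i, -, h, hi⟩
        exact ⟨h, i, hi⟩
    · intro i _ j _ hij
      rw [Function.onFun, Finset.disjoint_left]
      intro A hA hA'
      rw [closing, Finset.mem_filter] at hA hA'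
      exact hij ((mem_completions.1 hA.1).1.inn i j t hA.2 hA'.2)

/-- Adding the arc that closes `j` at `t`, when `t` is not also an opener. -/
lemma isOpenSystem_erase_iff {j : ℕ} (hL : ∀ x ∈ L, x < t) (ht : t < N) (hj : j ∈ L)
    (hA : (j, t) ∉ A) :
    (IsOpenSystem b N (t + 1) (L.erase j) A ∨
      (b = false ∧ IsOpenSystem b N (t + 1) (insert t (L.erase j)) A)) ↔
      IsOpenSystem b N t L (insert (j, t) A) := by
  have hjt := hL j hj
  constructor
  · intro h
    have hor := h
    have hs : ∀ i k, (i, k) ∈ A → i ∈ L.erase j ∨ t ≤ i := by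
      rcases h with h | ⟨-, h⟩
      · intro i k hik
        exact (h.src i k hik).imp_right fun h => by omega
      · intro i k hik
        rcases h.src i k hik with h1 | h1
        · rcases Finset.mem_insert.1 h1 with rfl | h1
          · exact Or.inr le_rfl
          · exact Or.inl h1
        · exact Or.inr (by omega)
    obtain ⟨L', h, hd⟩ : ∃ L', IsOpenSystem b N (t + 1) L' A ∧ L.erase j ⊆ L' := by
      rcases h with h | ⟨-, h⟩
      · exact ⟨_, h, subset_rfl⟩
      · exact ⟨_, h, Finset.subset_insert _ _⟩
    have hjA : ∀ k, (j, k) ∉ A := by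
      intro k hk
      rcases hs j k hk with h1 | h1
      · simp at h1
      · omega
    have htA : ∀ i, (i, t) ∉ A := by
      intro i hi
      have := h.ge i t hi
      omega
    refine ⟨?_, ?_, ?_, ?_, ?_, ?_, ?_, ?_⟩
    · intro i k hik
      rcases Finset.mem_insert.1 hik with h1 | h1
      · obtain ⟨rfl, rfl⟩ := Prod.mk.inj h1
        exact Or.inl hj
      · exact (hs i k h1).imp_left Finset.mem_of_mem_erase
    · intro i k hik
      rcases Finset.mem_insert.1 hik with h1 | h1
      · obtain ⟨rfl, rfl⟩ := Prod.mk.inj h1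
        exact hjt
      · exact h.lt i k h1
    · intro i k hik
      rcases Finset.mem_insert.1 hik with h1 | h1
      · obtain ⟨rfl, rfl⟩ := Prod.mk.inj h1
        exact le_rfl
      · have := h.ge i k h1
        omega
    · intro i k hik
      rcases Finset.mem_insert.1 hik with h1 | h1
      · obtain ⟨rfl, rfl⟩ := Prod.mk.inj h1
        exact ht
      · exact h.bd i k h1
    · intro i k l hk hl
      rcases Finset.mem_insert.1 hk with h1 | h1 <;> rcases Finset.mem_insert.1 hl with h2 | h2
      · rw [Prod.mk.injEq] at h1 h2
        omega
      · obtain ⟨rfl, rfl⟩ := Prod.mk.inj h1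
        exact absurd h2 (hjA _)
      · obtain ⟨rfl, rfl⟩ := Prod.mk.inj h2
        exact absurd h1 (hjA _)
      · exact h.out i k l h1 h2
    · intro i k l hk hl
      rcases Finset.mem_insert.1 hk with h1 | h1 <;> rcases Finset.mem_insert.1 hl with h2 | h2
      · rw [Prod.mk.injEq] at h1 h2
        omega
      · obtain ⟨rfl, rfl⟩ := Prod.mk.inj h1
        exact absurd h2 (htA _)
      · obtain ⟨rfl, rfl⟩ := Prod.mk.inj h2
        exact absurd h1 (htA _)
      · exact h.inn i k l h1 h2
    · intro i hi
      by_cases hij : i = j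
      · exact ⟨t, by rw [hij]; exact Finset.mem_insert_self _ _⟩
      · obtain ⟨k, hk⟩ := h.dang i (hd (Finset.mem_erase.2 ⟨hij, hi⟩))
        exact ⟨k, Finset.mem_insert_of_mem hk⟩
    · intro hb p hp hpN
      have hpj : p ≠ j := by omega
      have h1 : ∀ k, (p, k) ∈ insert (j, t) A ↔ (p, k) ∈ A := fun k => by simp [hpj]
      simp only [h1]
      rcases eq_or_lt_of_le hp with rfl | hp
      · rcases hor with h' | ⟨h', -⟩
        · have h2 : ∀ k, (t, k) ∉ A := by
            intro k hk
            rcases h'.src t k hk with h3 | h3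
            · exact hpj (hL t (Finset.mem_of_mem_erase h3)).false.elim
            · omega
          have h3 : ∃ i, (i, t) ∈ insert (j, t) A := ⟨j, Finset.mem_insert_self _ _⟩
          intro h4
          obtain ⟨k, hk⟩ := h4.2 h3
          exact h2 k hk
        · rw [hb] at h'
          exact absurd h' (by decide)
      · have h2 : ∀ i, (i, p) ∈ insert (j, t) A ↔ (i, p) ∈ A := fun i => by
          have : p ≠ t := by omega
          simp [this]
        simp only [h2]
        exact h.perf hb p hp hpN
  · intro h
    have hin : ∀ i k, (i, k) ∈ A → (i, k) ∈ insert (j, t) A := fun i k =>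
      Finset.mem_insert_of_mem
    have hjA : ∀ k, (j, k) ∉ A := by
      intro k hk
      obtain rfl := h.out j k t (hin _ _ hk) (Finset.mem_insert_self _ _)
      exact hA hk
    have htA : ∀ i, (i, t) ∉ A := by
      intro i hi
      obtain rfl := h.inn i j t (hin _ _ hi) (Finset.mem_insert_self _ _)
      exact hA hi
    have h0 : IsOpenSystem false N t (L.erase j) A := by
      refine ⟨?_, fun i k hk => h.lt i k (hin _ _ hk), fun i k hk => h.ge i k (hin _ _ hk),
        fun i k hk => h.bd i k (hin _ _ hk),
        fun i k l hk hl => h.out i k l (hin _ _ hk) (hin _ _ hl),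
        fun i k l hk hl => h.inn i k l (hin _ _ hk) (hin _ _ hl), ?_, by simp⟩
      · intro i k hk
        refine (h.src i k (hin _ _ hk)).imp_left fun hi => Finset.mem_erase.2 ⟨?_, hi⟩
        rintro rfl
        exact hjA k hk
      · intro i hi
        rw [Finset.mem_erase] at hi
        obtain ⟨k, hk⟩ := h.dang i hi.2
        rcases Finset.mem_insert.1 hk with h1 | h1
        · exact absurd (Prod.mk.inj h1).1 hi.1
        · exact ⟨k, h1⟩
    have hL' : ∀ x ∈ L.erase j, x < t := fun x hx => hL x (Finset.mem_of_mem_erase hx)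
    -- The closer `t` may open the next arc of its block; this is excluded for perfect matchings.
    by_cases hto : ∃ k, (t, k) ∈ A
    · right
      have hb : b = false := by
        by_contra hb
        rw [Bool.not_eq_false] at hb
        obtain ⟨k, hk⟩ := hto
        exact h.perf hb t le_rfl ht ⟨fun _ => ⟨j, Finset.mem_insert_self _ _⟩,
          fun _ => ⟨k, hin _ _ hk⟩⟩
      subst hb
      exact ⟨rfl, (isOpenSystem_insert_iff hL' ht).2 ⟨h0, by simpa using htA, hto⟩⟩
    · left
      have h1 := ((isOpenSystem_succ_iff hL' ht).2 ⟨h0, by simpa using htA, hto⟩).2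
      refine ⟨h1.src, h1.lt, h1.ge, h1.bd, h1.out, h1.inn, h1.dang, ?_⟩
      intro hb p hp hpN
      have h2 : ∀ k, (p, k) ∈ insert (j, t) A ↔ (p, k) ∈ A := fun k => by
        have : p ≠ j := by omega
        simp [this]
      have h3 : ∀ i, (i, p) ∈ insert (j, t) A ↔ (i, p) ∈ A := fun i => by
        have : p ≠ t := by omega
        simp [this]
      have h4 := h.perf hb p (by omega) hpN
      simpa only [h2, h3] using h4

/-- Adding the arc `(j, t)`: the conditions on the other arcs. -/
lemma avoids_insert_iff {j : ℕ} (hL : ∀ x ∈ L, x < t) (hj : j ∈ L) (hA : (j, t) ∉ A)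
    (h : IsOpenSystem b N t L (insert (j, t) A)) :
    (AvoidsBoth (insert (j, t) A) ∧ IsChained L c d (insert (j, t) A)) ↔
      (AvoidsBoth A ∧ IsChained (L.erase j) c d A ∧ IsChained (L.erase j) j t A) ∧
      (∀ x ∈ L, x < j → ¬ j < c) ∧ (j < c → ∀ y ∈ L, c ≤ y → ¬ y < d) := by
  have hjt := hL j hj
  have hin : ∀ {i k}, (i, k) ∈ A → (i, k) ∈ insert (j, t) A := fun {i k} =>
    Finset.mem_insert_of_mem
  have hself : (j, t) ∈ insert (j, t) A := Finset.mem_insert_self _ _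
  have hge : ∀ i k, (i, k) ∈ A → t < k := by
    intro i k hik
    refine lt_of_le_of_ne (h.ge i k (hin hik)) ?_
    rintro rfl
    obtain rfl := h.inn i j t (hin hik) hself
    exact hA hik
  have hne : ∀ i k, (i, k) ∈ A → i ≠ j := by
    rintro i k hik rfl
    obtain rfl := h.out i k t (hin hik) hself
    exact hA hik
  constructor
  · rintro ⟨⟨h1, h2⟩, h3, h4⟩
    refine ⟨⟨⟨?_, ?_⟩, ⟨?_, ?_⟩, ⟨?_, ?_⟩⟩, ?_, ?_⟩
    · intro i₁ i₂ i₃ j₁ j₂ j₃ a1 a2 a3 a4 a5 a6 a7 a8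
      exact h1 i₁ i₂ i₃ j₁ j₂ j₃ a1 a2 a3 a4 a5 (hin a6) (hin a7) (hin a8)
    · intro i₁ i₂ i₃ j₁ j₂ j₃ a1 a2 a3 a4 a5 a6 a7 a8
      exact h2 i₁ i₂ i₃ j₁ j₂ j₃ a1 a2 a3 a4 a5 (hin a6) (hin a7) (hin a8)
    · intro x y k l hx hy hxy hyc hk hl
      exact h3 x y k l (Finset.mem_of_mem_erase hx) (Finset.mem_of_mem_erase hy) hxy hyc (hin hk)
        (hin hl)
    · intro x y k l hx hy hxc hcy hyd hk hl
      exact h4 x y k l (Finset.mem_of_mem_erase hx) (Finset.mem_of_mem_erase hy) hxc hcy hyd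
        (hin hk) (hin hl)
    · intro x y k l hx hy hxy hyc hk hl
      by_contra hlt
      have hkl : k ≠ l := by
        rintro rfl
        have := h.inn x y k (hin hk) (hin hl)
        omega
      -- Closing `x` after `y` would nest `(j, t)` inside `(y, l)` inside `(x, k)`.
      exact h1 x y j t l k hxy hyc hjt (hge _ _ hl) (by omega) (hin hk) (hin hl) hself
    · intro x y k l hx hy hxc hcy hyd hk hl
      by_contra hlt
      have hkl : k ≠ l := by
        rintro rfl
        have := h.inn x y k (hin hk) (hin hl)
        omega
      have := hne _ _ hl
      -- Closing `x` before `y` would make `(x, k)`, `(j, t)`, `(y, l)` an occurrence of `231`.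
      exact h2 x j y t k l hxc (by omega) hyd (hge _ _ hk) (by omega) (hin hk) hself (hin hl)
    · intro x hx hxj hjc
      obtain ⟨k, hk⟩ := h.dang x hx
      have := h3 x j k t hx hj hxj hjc hk hself
      have := h.ge _ _ hk
      omega
    · intro hjc y hy hcy hyd
      obtain ⟨k, hk⟩ := h.dang y hy
      have := h4 j y t k hj hy hjc hcy hyd hself hk
      have := h.ge _ _ hk
      omega
  · rintro ⟨⟨⟨h1, h2⟩, ⟨h3, h4⟩, h5, h6⟩, h7, h8⟩
    have hLe : ∀ i k, (i, k) ∈ A → i < t → i ∈ L.erase j := by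
      intro i k hik hit
      rcases h.src i k (hin hik) with h9 | h9
      · exact Finset.mem_erase.2 ⟨hne _ _ hik, h9⟩
      · omega
    have hcase : ∀ i k, (i, k) ∈ insert (j, t) A → (i = j ∧ k = t) ∨ ((i, k) ∈ A ∧ t < k) := by
      intro i k hik
      rcases Finset.mem_insert.1 hik with h9 | h9
      · exact Or.inl (Prod.mk.inj h9)
      · exact Or.inr ⟨h9, hge _ _ h9⟩
    refine ⟨⟨?_, ?_⟩, ?_, ?_⟩
    · intro i₁ i₂ i₃ j₁ j₂ j₃ a1 a2 a3 a4 a5 a6 a7 a8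
      rcases hcase _ _ a8 with ⟨rfl, rfl⟩ | ⟨b8, c8⟩
      · rcases hcase _ _ a6 with b6 | ⟨b6, c6⟩
        · omega
        rcases hcase _ _ a7 with b7 | ⟨b7, c7⟩
        · omega
        have := h5 i₁ i₂ j₃ j₂ (hLe _ _ b6 (by omega)) (hLe _ _ b7 (by omega)) a1 a2 b6 b7
        omega
      · rcases hcase _ _ a6 with b6 | ⟨b6, c6⟩
        · omega
        rcases hcase _ _ a7 with b7 | ⟨b7, c7⟩
        · omega
        exact h1 i₁ i₂ i₃ j₁ j₂ j₃ a1 a2 a3 a4 a5 b6 b7 b8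
    · intro i₁ i₂ i₃ j₁ j₂ j₃ a1 a2 a3 a4 a5 a6 a7 a8
      rcases hcase _ _ a7 with ⟨rfl, rfl⟩ | ⟨b7, c7⟩
      · rcases hcase _ _ a6 with b6 | ⟨b6, c6⟩
        · omega
        rcases hcase _ _ a8 with b8 | ⟨b8, c8⟩
        · omega
        have := h6 i₁ i₃ j₂ j₃ (hLe _ _ b6 (by omega)) (hLe _ _ b8 (by omega)) a1 a2.le a3 b6 b8
        omega
      · rcases hcase _ _ a6 with b6 | ⟨b6, c6⟩
        · omega
        rcases hcase _ _ a8 with b8 | ⟨b8, c8⟩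
        · omega
        exact h2 i₁ i₂ i₃ j₁ j₂ j₃ a1 a2 a3 a4 a5 b6 b7 b8
    · intro x y k l hx hy hxy hyc hk hl
      rcases hcase _ _ hl with ⟨rfl, rfl⟩ | ⟨b1, c1⟩
      · exact absurd hyc (h7 x hx hxy)
      rcases hcase _ _ hk with ⟨rfl, rfl⟩ | ⟨b2, c2⟩
      · exact c1
      exact h3 x y k l (hLe _ _ b2 (hL _ hx)) (hLe _ _ b1 (hL _ hy)) hxy hyc b2 b1
    · intro x y k l hx hy hxc hcy hyd hk hl
      rcases hcase _ _ hk with ⟨rfl, rfl⟩ | ⟨b1, c1⟩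
      · exact absurd hyd (h8 hxc y hy hcy)
      rcases hcase _ _ hl with ⟨rfl, rfl⟩ | ⟨b2, c2⟩
      · exact c1
      exact h4 x y k l (hLe _ _ b1 (hL _ hx)) (hLe _ _ b2 (hL _ hy)) hxc hcy hyd b1 b2

/-- The completions in which `t` closes an arc, after removing this arc. -/
lemma card_closing {j c' d' : ℕ} (hL : ∀ x ∈ L, x < t) (ht : t < N) (hj : j ∈ L)
    (hc' : c' ≤ t) (hd' : d' ≤ t)
    (h7 : ∀ x ∈ L, x < j → ¬ j < c) (h8 : j < c → ∀ y ∈ L, c ≤ y → ¬ y < d)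
    (hch : ∀ A, (IsChained (L.erase j) c d A ∧ IsChained (L.erase j) j t A) ↔
      IsChained (L.erase j) c' d' A) :
    (closing b N t L c d j).card = (completions b N (t + 1) (L.erase j) c' d').card +
      if b then 0 else (completions b N (t + 1) (insert t (L.erase j)) c' d').card := by
  classical
  have hjt := hL j hj
  have hdisj : Disjoint (completions b N (t + 1) (L.erase j) c' d')
      (completions b N (t + 1) (insert t (L.erase j)) c' d') := by
    rw [Finset.disjoint_left]
    intro A hA hA'
    obtain ⟨k, hk⟩ := (mem_completions.1 hA').1.dang t (Finset.mem_insert_self _ _)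
    rcases (mem_completions.1 hA).1.src t k hk with h | h
    · exact (hL t (Finset.mem_of_mem_erase h)).false
    · omega
  have hcard : (completions b N (t + 1) (L.erase j) c' d').card +
      (if b then 0 else (completions b N (t + 1) (insert t (L.erase j)) c' d').card) =
      (completions b N (t + 1) (L.erase j) c' d' ∪
        if b then ∅ else completions b N (t + 1) (insert t (L.erase j)) c' d').card := by
    rw [Finset.card_union_of_disjoint]
    · split_ifs <;> simp
    · split_ifs
      · simp
      · exact hdisj
  rw [hcard]
  have hmem : ∀ A, (A ∈ completions b N (t + 1) (L.erase j) c' d' ∪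
        if b then ∅ else completions b N (t + 1) (insert t (L.erase j)) c' d') ↔
      (IsOpenSystem b N (t + 1) (L.erase j) A ∨
      (b = false ∧ IsOpenSystem b N (t + 1) (insert t (L.erase j)) A)) ∧
      AvoidsBoth A ∧ IsChained (L.erase j) c' d' A := by
    intro A
    rw [Finset.mem_union, mem_completions]
    cases b
    · simp only [Bool.false_eq_true, if_false, mem_completions, isChained_insert hc' hd']
      tauto
    · simp
  have hmem' : ∀ A, (j, t) ∉ A → (insert (j, t) A ∈ closing b N t L c d j ↔
      A ∈ completions b N (t + 1) (L.erase j) c' d' ∪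
        if b then ∅ else completions b N (t + 1) (insert t (L.erase j)) c' d') := by
    intro A hA
    rw [hmem, closing, Finset.mem_filter, mem_completions, isOpenSystem_erase_iff hL ht hj hA,
      ← hch]
    constructor
    · rintro ⟨⟨h1, h2⟩, -⟩
      exact ⟨h1, ((avoids_insert_iff hL hj hA h1).1 h2).1⟩
    · rintro ⟨h1, h2⟩
      exact ⟨⟨h1, (avoids_insert_iff hL hj hA h1).2 ⟨h2, h7, h8⟩⟩, Finset.mem_insert_self _ _⟩
  have hnot : ∀ A, (A ∈ completions b N (t + 1) (L.erase j) c' d' ∪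
        if b then ∅ else completions b N (t + 1) (insert t (L.erase j)) c' d') → (j, t) ∉ A := by
    intro A hA hjA
    rw [hmem] at hA
    rcases hA.1 with h | ⟨-, h⟩ <;>
    · have := h.ge j t hjA
      omega
  refine Finset.card_nbij' (fun A => A.erase (j, t)) (fun A => insert (j, t) A) ?_ ?_ ?_ ?_
  · intro A hA
    have h1 : (j, t) ∈ A := (Finset.mem_filter.1 hA).2
    refine (hmem' _ (Finset.notMem_erase _ _)).1 ?_
    rwa [Finset.insert_erase h1]
  · intro A hA
    exact (hmem' A (hnot A hA)).2 hA
  · intro A hA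
    exact Finset.insert_erase (Finset.mem_filter.1 hA).2
  · intro A hA
    exact Finset.erase_insert (hnot A hA)

lemma card_closing_eq_zero {j : ℕ} (hL : ∀ x ∈ L, x < t) (hj : j ∈ L)
    (h : ∀ A, IsOpenSystem b N t L (insert (j, t) A) →
      IsChained (L.erase j) c d A → IsChained (L.erase j) j t A →
      (∀ x ∈ L, x < j → ¬ j < c) → (j < c → ∀ y ∈ L, c ≤ y → ¬ y < d) → False) :
    (closing b N t L c d j).card = 0 := by
  rw [Finset.card_eq_zero, Finset.eq_empty_iff_forall_notMem]
  intro A hA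
  rw [closing, Finset.mem_filter, mem_completions] at hA
  obtain ⟨⟨h1, h2⟩, h3⟩ := hA
  rw [← Finset.insert_erase h3] at h1 h2
  obtain ⟨⟨h4, h5, h6⟩, h7, h8⟩ := (avoids_insert_iff hL hj (Finset.notMem_erase _ _) h1).1 h2
  exact h _ h1 h5 h6 h7 h8

end Completions

section Counting

/-! ### Counting the completions -/

/-- The number of elements of `L` below `c`. -/
def rank (L : Finset ℕ) (c : ℕ) : ℕ := (L.filter (· < c)).card

lemma rank_le (L : Finset ℕ) (c : ℕ) : rank L c ≤ L.card := Finset.card_filter_le _ _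

lemma rank_mono (L : Finset ℕ) {c d : ℕ} (h : c ≤ d) : rank L c ≤ rank L d :=
  Finset.card_le_card fun x hx => by
    rw [Finset.mem_filter] at hx ⊢
    exact ⟨hx.1, by omega⟩

lemma rank_of_forall_lt {L : Finset ℕ} {t : ℕ} (h : ∀ x ∈ L, x < t) : rank L t = L.card := by
  rw [rank, Finset.filter_true_of_mem h]

lemma rank_insert_of_le {L : Finset ℕ} {c t : ℕ} (h : c ≤ t) :
    rank (insert t L) c = rank L c := by
  rw [rank, Finset.filter_insert, if_neg (by omega), rank]

lemma rank_erase_of_le {L : Finset ℕ} {c j : ℕ} (h : c ≤ j) :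
    rank (L.erase j) c = rank L c := by
  rw [rank, rank]
  congr 1
  ext x
  simp only [Finset.mem_filter, Finset.mem_erase]
  constructor
  · rintro ⟨⟨-, h1⟩, h2⟩
    exact ⟨h1, h2⟩
  · rintro ⟨h1, h2⟩
    exact ⟨⟨by omega, h1⟩, h2⟩

lemma rank_erase_of_lt {L : Finset ℕ} {c j : ℕ} (hj : j ∈ L) (h : j < c) :
    rank (L.erase j) c = rank L c - 1 := by
  rw [rank, rank, ← Finset.card_erase_of_mem (a := j) (Finset.mem_filter.2 ⟨hj, h⟩)]
  congr 1
  ext x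
  simp only [Finset.mem_filter, Finset.mem_erase]
  tauto

lemma rank_pos {L : Finset ℕ} {c : ℕ} : 0 < rank L c ↔ ∃ x ∈ L, x < c := by
  rw [rank, Finset.card_pos]
  constructor
  · rintro ⟨x, hx⟩
    exact ⟨x, Finset.mem_filter.1 hx⟩
  · rintro ⟨x, hx⟩
    exact ⟨x, Finset.mem_filter.2 hx⟩

lemma rank_lt_rank {L : Finset ℕ} {c d : ℕ} (hcd : c ≤ d) :
    rank L c < rank L d ↔ ∃ x ∈ L, c ≤ x ∧ x < d := by
  have h : (L.filter (· < c)) ⊆ L.filter (· < d) := fun x hx => by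
    rw [Finset.mem_filter] at hx ⊢
    exact ⟨hx.1, by omega⟩
  have h2 := Finset.card_sdiff_add_card_eq_card h
  rw [rank, rank]
  have h3 : 0 < (L.filter (· < d) \ L.filter (· < c)).card ↔ ∃ x ∈ L, c ≤ x ∧ x < d := by
    rw [Finset.card_pos]
    constructor
    · rintro ⟨x, hx⟩
      rw [Finset.mem_sdiff, Finset.mem_filter, Finset.mem_filter] at hx
      exact ⟨x, hx.1.1, by_contra fun h => hx.2 ⟨hx.1.1, by omega⟩, hx.1.2⟩
    · rintro ⟨x, h1, h2, h3⟩
      refine ⟨x, ?_⟩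
      rw [Finset.mem_sdiff, Finset.mem_filter, Finset.mem_filter]
      exact ⟨⟨h1, h3⟩, fun h => by omega⟩
  rw [← h3]
  omega

/-- This turns the sum over the closed arc into the sum over `k` in the transfer equations. Adding a
new maximum does not change the ranks of the other elements, which is why the induction goes
upwards. -/
lemma sum_rank {M : Type*} [AddCommMonoid M] (g : ℕ → M) (c : ℕ) (L : Finset ℕ) :
    ∑ j ∈ L.filter (c ≤ ·), g (rank L j) = ∑ k ∈ Finset.Ico (rank L c) L.card, g k := by
  induction L using Finset.induction_on_max with
  | empty => simp
  | insert m L hm ih =>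
    have hmL : m ∉ L := fun h => (hm m h).false
    have hr : ∀ x, x ≤ m → rank (insert m L) x = rank L x := fun x hx => rank_insert_of_le hx
    rw [Finset.filter_insert, Finset.card_insert_of_notMem hmL]
    split_ifs with h
    · rw [Finset.sum_insert (fun h => hmL (Finset.mem_filter.1 h).1), hr m le_rfl, hr c h,
        rank_of_forall_lt hm, Finset.sum_Ico_succ_top (rank_le L c), ← ih, add_comm]
      congr 1
      refine Finset.sum_congr rfl fun x hx => ?_
      rw [hr x (hm x (Finset.mem_filter.1 hx).1).le]
    · have h1 : L.filter (c ≤ ·) = ∅ := by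
        rw [Finset.filter_eq_empty_iff]
        intro x hx hcx
        have := hm x hx
        omega
      have h2 : rank (insert m L) c = L.card + 1 := by
        rw [rank_of_forall_lt, Finset.card_insert_of_notMem hmL]
        intro x hx
        rcases Finset.mem_insert.1 hx with rfl | hx
        · omega
        · have := hm x hx
          omega
      rw [h1, h2]
      simp

/-! ### The recursion on the first remaining point -/

variable {b : Bool} {N t : ℕ} {L : Finset ℕ} {c d : ℕ}
  {S₁ S₂ : ℕ → ℕ → ℚ⟦X⟧}

/-- The statement that the completions of all states at time `t` are counted by `S₁`, `S₂`. -/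
def CountedBy (S₁ S₂ : ℕ → ℕ → ℚ⟦X⟧) (b : Bool) (N t n : ℕ) : Prop :=
  ∀ (L : Finset ℕ) (c d : ℕ), (∀ x ∈ L, x < t) → c ≤ d → d ≤ t →
    ((completions b N t L c d).card : ℚ) = PowerSeries.coeff n
      (stateValue S₁ S₂ (rank L c) (rank L d - rank L c) (L.card - rank L d))

lemma cast_card_closing {n j c' d' : ℕ} (ih : CountedBy S₁ S₂ b N (t + 1) n)
    (hL : ∀ x ∈ L, x < t) (ht : t < N) (hj : j ∈ L) (hcd' : c' ≤ d') (hd' : d' ≤ t)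
    (h7 : ∀ x ∈ L, x < j → ¬ j < c) (h8 : j < c → ∀ y ∈ L, c ≤ y → ¬ y < d)
    (hch : ∀ A, (IsChained (L.erase j) c d A ∧ IsChained (L.erase j) j t A) ↔
      IsChained (L.erase j) c' d' A) :
    ((closing b N t L c d j).card : ℚ) = PowerSeries.coeff n
      (stateValue S₁ S₂ (rank (L.erase j) c') (rank (L.erase j) d' - rank (L.erase j) c')
        (L.card - 1 - rank (L.erase j) d') + PowerSeries.C (if b then 0 else 1) *
      stateValue S₁ S₂ (rank (L.erase j) c') (rank (L.erase j) d' - rank (L.erase j) c')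
        (L.card - 1 - rank (L.erase j) d' + 1)) := by
  have hL' : ∀ x ∈ L.erase j, x < t := fun x hx => hL x (Finset.mem_of_mem_erase hx)
  have htL : t ∉ L.erase j := fun h => (hL' t h).false
  have hle := rank_le (L.erase j) d'
  have hpos := Finset.card_pos.2 ⟨j, hj⟩
  rw [card_closing hL ht hj (hcd'.trans hd') hd' h7 h8 hch, Nat.cast_add,
    ih (L.erase j) c' d' (fun x hx => (hL' x hx).trans (Nat.lt_succ_self t)) hcd' (by omega),
    map_add, Finset.card_erase_of_mem hj]
  congr 1
  cases b
  · simp only [Bool.false_eq_true, if_false, map_one, one_mul]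
    rw [ih (insert t (L.erase j)) c' d' ?_ hcd' (by omega), rank_insert_of_le (hcd'.trans hd'),
      rank_insert_of_le hd', Finset.card_insert_of_notMem htL, Finset.card_erase_of_mem hj]
    · rw [Finset.card_erase_of_mem hj] at hle
      rw [show L.card - 1 + 1 - rank (L.erase j) d' = L.card - 1 - rank (L.erase j) d' + 1 by omega]
    · intro x hx
      rcases Finset.mem_insert.1 hx with rfl | hx
      · omega
      · exact (hL' x hx).trans (Nat.lt_succ_self t)
  · simp

/-- Closing an arc above the chain. -/
lemma cast_card_closing_upper {n j : ℕ} (ih : CountedBy S₁ S₂ b N (t + 1) n)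
    (hL : ∀ x ∈ L, x < t) (ht : t < N) (hj : j ∈ L) (hcj : c ≤ j)
    (hdec : ∀ x ∈ L, ∀ y ∈ L, x < c → c ≤ y → y < d → j ≤ y) :
    ((closing b N t L c d j).card : ℚ) = PowerSeries.coeff n
      (stateValue S₁ S₂ (rank L j) (L.card - 1 - rank L j) 0 +
        PowerSeries.C (if b then 0 else 1) *
          stateValue S₁ S₂ (rank L j) (L.card - 1 - rank L j) 1) := by
  have hjt := hL j hj
  rw [cast_card_closing (c' := j) (d' := t) ih hL ht hj hjt.le le_rfl (fun _ _ _ => by omega)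
    (fun h => by omega)]
  · have h1 : rank (L.erase j) t = L.card - 1 := by
      rw [rank_of_forall_lt fun x hx => hL x (Finset.mem_of_mem_erase hx),
        Finset.card_erase_of_mem hj]
    rw [h1, rank_erase_of_le le_rfl]
    simp
  · intro A
    -- The new constraint subsumes the old one: since `c ≤ j`, the old chain lies below `j`, and by
    -- `hdec` the arcs that had to precede a nonempty chain lie above `j`.
    refine and_iff_right_of_imp fun h => ⟨?_, ?_⟩
    · exact fun x y k l hx hy hxy hyc => h.inc x y k l hx hy hxy (by omega)
    · intro x y k l hx hy hxc hcy hyd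
      have h1 := hdec x (Finset.mem_of_mem_erase hx) y (Finset.mem_of_mem_erase hy) hxc hcy hyd
      have h2 : y ≠ j := (Finset.mem_erase.1 hy).1
      exact h.dec x y k l hx hy (by omega) (by omega) (hL y (Finset.mem_of_mem_erase hy))

/-- Closing the first arc of the chain. -/
lemma cast_card_closing_bottom {n j : ℕ} (ih : CountedBy S₁ S₂ b N (t + 1) n)
    (hL : ∀ x ∈ L, x < t) (ht : t < N) (hj : j ∈ L) (hjc : j < c) (hcd : c ≤ d) (hdt : d ≤ t)
    (hmin : ∀ x ∈ L, j ≤ x) (hQ : rank L d = rank L c) :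
    ((closing b N t L c d j).card : ℚ) = PowerSeries.coeff n
      (S₁ (rank L c - 1) (L.card - rank L c) +
        PowerSeries.C (if b then 0 else 1) * S₁ (rank L c - 1) (L.card - rank L c + 1)) := by
  have hQ' : ∀ y ∈ L, c ≤ y → ¬ y < d := by
    intro y hy hcy hyd
    exact absurd ((rank_lt_rank hcd).2 ⟨y, hy, hcy, hyd⟩) (by omega)
  have hpos : 0 < rank L c := rank_pos.2 ⟨j, hj, hjc⟩
  rw [cast_card_closing (c' := c) (d' := d) ih hL ht hj hcd hdt
    (fun x hx hxj => absurd (hmin x hx) (by omega)) (fun _ => hQ')]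
  · rw [rank_erase_of_lt hj hjc, rank_erase_of_lt hj (by omega), hQ, Nat.sub_self,
      show L.card - 1 - (rank L c - 1) = L.card - rank L c by omega]
    simp [stateValue]
  · intro A
    -- No open arc lies below `j`, so closing it creates no new constraint.
    refine and_iff_left_of_imp fun h => ⟨?_, ?_⟩
    · intro x y k l hx hy hxy hyj
      exact absurd (hmin y (Finset.mem_of_mem_erase hy)) (by omega)
    · intro x y k l hx hy hxj
      exact absurd (hmin x (Finset.mem_of_mem_erase hx)) (by omega)

lemma card_closing_chain_eq_zero {j x : ℕ} (hL : ∀ x ∈ L, x < t) (hj : j ∈ L) (hx : x ∈ L)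
    (hxj : x < j) (hjc : j < c) : (closing b N t L c d j).card = 0 :=
  card_closing_eq_zero hL hj fun _ _ _ _ h7 _ => h7 x hx hxj hjc

lemma card_closing_bottom_eq_zero {j y : ℕ} (hL : ∀ x ∈ L, x < t) (hj : j ∈ L) (hjc : j < c)
    (hy : y ∈ L) (hcy : c ≤ y) (hyd : y < d) : (closing b N t L c d j).card = 0 :=
  card_closing_eq_zero hL hj fun _ _ _ _ _ h8 => h8 hjc y hy hcy hyd

/-- The old constraint closes `y` before `x`; closing `j` first would chain everything below `j`,
hence `x` before `y`. -/
lemma card_closing_upper_eq_zero {j x y : ℕ} (hL : ∀ x ∈ L, x < t) (hj : j ∈ L)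
    (hx : x ∈ L) (hxc : x < c) (hy : y ∈ L) (hcy : c ≤ y) (hyd : y < d) (hyj : y < j) :
    (closing b N t L c d j).card = 0 := by
  refine card_closing_eq_zero hL hj fun A hA h5 h6 _ _ => ?_
  have h : ∀ i ∈ L, i ≠ j → ∃ k, (i, k) ∈ A := by
    intro i hi hij
    obtain ⟨k, hk⟩ := hA.dang i hi
    rcases Finset.mem_insert.1 hk with h1 | h1
    · exact absurd (Prod.mk.inj h1).1 hij
    · exact ⟨k, h1⟩
  obtain ⟨k, hk⟩ := h x hx (by omega)
  obtain ⟨l, hl⟩ := h y hy (by omega)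
  have hx' : x ∈ L.erase j := Finset.mem_erase.2 ⟨by omega, hx⟩
  have hy' : y ∈ L.erase j := Finset.mem_erase.2 ⟨by omega, hy⟩
  have h1 := h5.dec x y k l hx' hy' hxc hcy hyd hk hl
  have h2 := h6.inc x y k l hx' hy' (by omega) hyj hk hl
  omega

lemma CountedBy.of_succ {n : ℕ} (sol : IsTransferSolution (if b then 0 else 1) S₁ S₂)
    (ht : t < N) (ih : CountedBy S₁ S₂ b N (t + 1) n) : CountedBy S₁ S₂ b N t (n + 1) := by
  intro L c d hL hcd hd
  have htL : t ∉ L := fun h => (hL t h).false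
  have hcd' := rank_mono L hcd
  have hdL := rank_le L d
  rw [card_completions hL ht (hcd.trans hd) hd, Nat.cast_add, Nat.cast_add, Nat.cast_sum]
  have e1 : (((if b then 0 else (completions b N (t + 1) L c d).card : ℕ)) : ℚ) =
      PowerSeries.coeff n (PowerSeries.C (if b then 0 else 1) *
        stateValue S₁ S₂ (rank L c) (rank L d - rank L c) (L.card - rank L d)) := by
    cases b
    · simp only [Bool.false_eq_true, if_false, map_one, one_mul]
      exact ih L c d (fun x hx => (hL x hx).trans (Nat.lt_succ_self t)) hcd (by omega)
    · simp
  have e2 : ((completions b N (t + 1) (insert t L) c d).card : ℚ) = PowerSeries.coeff n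
      (stateValue S₁ S₂ (rank L c) (rank L d - rank L c) (L.card - rank L d + 1)) := by
    rw [ih (insert t L) c d ?_ hcd (by omega), rank_insert_of_le hd,
      rank_insert_of_le (hcd.trans hd), Finset.card_insert_of_notMem htL,
      show L.card + 1 - rank L d = L.card - rank L d + 1 by omega]
    intro x hx
    rcases Finset.mem_insert.1 hx with rfl | hx
    · omega
    · exact (hL x hx).trans (Nat.lt_succ_self t)
  rw [e1, e2]
  set g : ℕ → ℚ := fun k => PowerSeries.coeff n (stateValue S₁ S₂ k (L.card - 1 - k) 0 +
    PowerSeries.C (if b then 0 else 1) * stateValue S₁ S₂ k (L.card - 1 - k) 1) with hg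
  -- If one of the two groups is empty, the precedence between them is vacuous and the second group
  -- is as good as free.
  by_cases hI : rank L c = 0 ∨ rank L d - rank L c = 0
  · have hv : ∀ f, stateValue S₁ S₂ (rank L c) (rank L d - rank L c) f =
        S₁ (rank L c) (rank L d - rank L c + f) := fun f => by rw [stateValue, if_pos hI]
    have hupper : ∑ j ∈ L.filter (c ≤ ·), ((closing b N t L c d j).card : ℚ) =
        ∑ k ∈ Finset.Ico (rank L c) L.card, g k := by
      rw [← sum_rank g c L]
      refine Finset.sum_congr rfl fun j hj => ?_
      rw [Finset.mem_filter] at hj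
      refine cast_card_closing_upper ih hL ht hj.1 hj.2 fun x hx y hy hxc hcy hyd => ?_
      have h1 := rank_pos.2 ⟨x, hx, hxc⟩
      have h2 := (rank_lt_rank hcd).2 ⟨y, hy, hcy, hyd⟩
      omega
    have hlower : ∑ j ∈ L.filter (fun j => ¬ c ≤ j), ((closing b N t L c d j).card : ℚ) =
        PowerSeries.coeff n (if rank L c = 0 then 0 else
          S₁ (rank L c - 1) (L.card - rank L c) + PowerSeries.C (if b then 0 else 1) *
            S₁ (rank L c - 1) (L.card - rank L c + 1)) := by
      by_cases h0 : rank L c = 0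
      · rw [if_pos h0, map_zero]
        refine Finset.sum_eq_zero fun j hj => ?_
        rw [Finset.mem_filter] at hj
        exact absurd (rank_pos.2 ⟨j, hj.1, not_le.1 hj.2⟩) (by omega)
      · obtain ⟨x, hx, hxc⟩ := rank_pos.1 (Nat.pos_of_ne_zero h0)
        have hne : L.Nonempty := ⟨x, hx⟩
        have hm := Finset.min'_mem L hne
        have hmx := Finset.min'_le L x hx
        have := cast_card_closing_bottom ih hL ht hm (by omega) hcd hd
          (fun y hy => Finset.min'_le L y hy) (by omega)
        rw [if_neg h0, ← this]
        refine Finset.sum_eq_single _ (fun j hj hjm => ?_) (fun h => ?_)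
        · rw [Finset.mem_filter] at hj
          have := Finset.min'_le L j hj.1
          rw [card_closing_chain_eq_zero hL hj.1 hm (by omega) (by omega), Nat.cast_zero]
        · exact absurd (Finset.mem_filter.2 ⟨hm, by omega⟩) h
    rw [← Finset.sum_filter_add_sum_filter_not L (c ≤ ·), hupper, hlower, hv, hv]
    have h3 : rank L d - rank L c + (L.card - rank L d) = L.card - rank L c := by omega
    have h4 : rank L c + (L.card - rank L c) = L.card := by omega
    have h5 : PowerSeries.coeff (n + 1) (if rank L c = 0 ∧ L.card - rank L c = 0 then
        (1 : ℚ⟦X⟧) else 0) = 0 := by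
      split_ifs <;> simp [PowerSeries.coeff_one]
    have h3' : rank L d - rank L c + (L.card - rank L d + 1) = L.card - rank L c + 1 := by omega
    rw [h3, h3']
    conv_rhs => rw [sol.eq₁, h4, map_add, PowerSeries.coeff_succ_X_mul, h5]
    simp only [map_add, map_sum, hg]
    ring
  · have hv : ∀ f, stateValue S₁ S₂ (rank L c) (rank L d - rank L c) f =
        S₂ (rank L c) (rank L d - rank L c + f) := fun f => by rw [stateValue, if_neg hI]
    push Not at hI
    obtain ⟨x, hx, hxc⟩ := rank_pos.1 (Nat.pos_of_ne_zero hI.1)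
    obtain ⟨y, hy, hcy, hyd⟩ := (rank_lt_rank (L := L) hcd).1 (by omega)
    set Q := L.filter fun y => c ≤ y ∧ y < d with hQ
    have hne : Q.Nonempty := ⟨y, Finset.mem_filter.2 ⟨hy, hcy, hyd⟩⟩
    have hm := Finset.min'_mem Q hne
    have hmin : ∀ y ∈ L, c ≤ y → y < d → Q.min' hne ≤ y := fun y hy hcy hyd =>
      Finset.min'_le Q y (Finset.mem_filter.2 ⟨hy, hcy, hyd⟩)
    set m := Q.min' hne
    rw [hQ, Finset.mem_filter] at hm
    obtain ⟨hmL, hcm, hmd⟩ := hm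
    have hrank : rank L m = rank L c := by
      refine le_antisymm ?_ (rank_mono L hcm)
      by_contra h
      obtain ⟨y, hy, hcy, hym⟩ := (rank_lt_rank hcm).1 (not_le.1 h)
      exact absurd (hmin y hy hcy (by omega)) (by omega)
    -- Only `m`, the lowest of the arcs that precede the chain, can be closed now; the chain then
    -- keeps its size.
    have hsum : ∑ j ∈ L, ((closing b N t L c d j).card : ℚ) = g (rank L c) := by
      rw [Finset.sum_eq_single m, cast_card_closing_upper ih hL ht hmL hcm
        (fun x hx y hy _ hcy hyd => hmin y hy hcy hyd), hrank]
      · intro j hj hjm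
        rw [Nat.cast_eq_zero]
        rcases lt_or_ge j c with hjc | hcj
        · exact card_closing_bottom_eq_zero hL hj hjc hmL hcm hmd
        · refine card_closing_upper_eq_zero hL hj hx hxc hmL hcm hmd ?_
          by_contra h
          exact absurd (hmin j hj hcj (by omega)) (by omega)
      · exact fun h => absurd hmL h
    have h3 : rank L d - rank L c + (L.card - rank L d) = L.card - rank L c := by omega
    have h3' : rank L d - rank L c + (L.card - rank L d + 1) = L.card - rank L c + 1 := by omega
    rw [hsum, hv, hv, h3, h3']
    conv_rhs => rw [sol.eq₂ _ _ (by omega) (by omega), PowerSeries.coeff_succ_X_mul,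
      show L.card - rank L c - 1 = L.card - 1 - rank L c by omega]
    simp only [map_add, hg]

/-- The factor `X` in the transfer equations determines each coefficient from the preceding one,
just as the counts with `n` remaining points are determined by those with one fewer. No separate
uniqueness statement is needed. -/
theorem countedBy (sol : IsTransferSolution (if b then 0 else 1) S₁ S₂) (n : ℕ) :
    ∀ t, t + n = N → CountedBy S₁ S₂ b N t n := by
  induction n with
  | zero =>
    rintro t rfl L c d hL hcd hd
    have hcd' := rank_mono L hcd
    have hdL := rank_le L d
    rw [add_zero, completions_self hL, stateValue]
    split_ifs with h1 h2 h2
    · subst h1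
      rw [sol.eq₁]
      simp [rank]
    · exact absurd (Or.inl (by subst h1; simp [rank])) h2
    · have h3 := Finset.card_pos.2 (Finset.nonempty_iff_ne_empty.2 h1)
      rw [sol.eq₁, if_neg (by omega)]
      simp
    · push Not at h2
      rw [sol.eq₂ _ _ (by omega) (by omega)]
      simp
  | succ n ih =>
    intro t ht
    exact CountedBy.of_succ sol (by omega) (ih (t + 1) (by omega))

theorem card_completions_eq_coeff (sol : IsTransferSolution (if b then 0 else 1) S₁ S₂) (n : ℕ) :
    ((completions b n 0 ∅ 0 0).card : ℚ) = PowerSeries.coeff n (S₁ 0 0) := by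
  rw [countedBy sol n 0 (zero_add n) ∅ 0 0 (by simp) le_rfl le_rfl]
  simp [stateValue, rank]

end Counting

/-! ### Partitions as sets of arcs -/

section ArcSets

variable {n : ℕ} {P Q : SetPartition n}

lemma isArc_iff {i j : Fin n} :
    IsArc P i j ↔ j ∈ P.part i ∧ i < j ∧ ∀ l ∈ P.part i, ¬ (i < l ∧ l < j) := by
  constructor
  · rintro ⟨B, hB, hi, hj, h⟩
    rw [P.part_eq_of_mem hB hi]
    exact ⟨hj, h⟩
  · rintro ⟨hj, h⟩
    exact ⟨P.part i, P.part_mem.2 (Finset.mem_univ _), P.mem_part_self.2 (Finset.mem_univ _), hj, h⟩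

lemma mem_part_comm {i j : Fin n} : j ∈ P.part i ↔ i ∈ P.part j := by
  rw [P.mem_part_iff_part_eq_part (Finset.mem_univ _) (Finset.mem_univ _),
    P.mem_part_iff_part_eq_part (Finset.mem_univ _) (Finset.mem_univ _), eq_comm]

lemma part_eq_of_mem_part {i j : Fin n} (h : j ∈ P.part i) : P.part j = P.part i :=
  (P.mem_part_iff_part_eq_part (Finset.mem_univ _) (Finset.mem_univ _)).1 h

lemma exists_isArc_of_lt {i j : Fin n} (hj : j ∈ P.part i) (hij : i < j) :
    ∃ s, IsArc P i s ∧ s ≤ j := by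
  have hne : ((P.part i).filter (i < ·)).Nonempty := ⟨j, Finset.mem_filter.2 ⟨hj, hij⟩⟩
  have hm := Finset.min'_mem _ hne
  rw [Finset.mem_filter] at hm
  refine ⟨_, isArc_iff.2 ⟨hm.1, hm.2, fun l hl h => ?_⟩,
    Finset.min'_le _ j (Finset.mem_filter.2 ⟨hj, hij⟩)⟩
  exact absurd (Finset.min'_le _ l (Finset.mem_filter.2 ⟨hl, h.1⟩)) (not_le.2 h.2)

lemma exists_isArc_of_gt {i j : Fin n} (hj : i ∈ P.part j) (hij : i < j) :
    ∃ s, IsArc P s j := by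
  have hne : ((P.part j).filter (· < j)).Nonempty := ⟨i, Finset.mem_filter.2 ⟨hj, hij⟩⟩
  have hm := Finset.max'_mem _ hne
  rw [Finset.mem_filter] at hm
  refine ⟨_, isArc_iff.2 ⟨mem_part_comm.1 hm.1, hm.2, fun l hl h => ?_⟩⟩
  rw [part_eq_of_mem_part hm.1] at hl
  exact absurd (Finset.le_max' _ l (Finset.mem_filter.2 ⟨hl, h.2⟩)) (not_le.2 h.1)

lemma transGen_isArc_of_mem_part {i j : Fin n} (hj : j ∈ P.part i) (hij : i < j) :
    Relation.TransGen (IsArc P) i j := by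
  induction hk : (j : ℕ) - i using Nat.strong_induction_on generalizing i with
  | _ k ih =>
    obtain ⟨s, hs, hsj⟩ := exists_isArc_of_lt hj hij
    have h := isArc_iff.1 hs
    rcases eq_or_lt_of_le hsj with rfl | hsj
    · exact Relation.TransGen.single hs
    · refine Relation.TransGen.head hs (ih (j - s) ?_ ?_ hsj rfl)
      · have := h.2.1
        rw [Fin.lt_def] at *
        omega
      · rwa [part_eq_of_mem_part h.1]

lemma mem_part_of_transGen {i j : Fin n} (h : Relation.TransGen (IsArc P) i j) :
    j ∈ P.part i := by
  induction h with
  | single h => exact (isArc_iff.1 h).1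
  | tail _ h ih =>
    have := (isArc_iff.1 h).1
    rwa [part_eq_of_mem_part ih] at this

lemma mem_part_iff_transGen {i j : Fin n} : j ∈ P.part i ↔
    i = j ∨ Relation.TransGen (IsArc P) i j ∨ Relation.TransGen (IsArc P) j i := by
  constructor
  · intro h
    rcases lt_trichotomy i j with hij | hij | hij
    · exact Or.inr (Or.inl (transGen_isArc_of_mem_part h hij))
    · exact Or.inl hij
    · exact Or.inr (Or.inr (transGen_isArc_of_mem_part (mem_part_comm.1 h) hij))
  · rintro (rfl | h | h)
    · exact P.mem_part_self.2 (Finset.mem_univ _)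
    · exact mem_part_of_transGen h
    · exact mem_part_comm.1 (mem_part_of_transGen h)

/-- Blocks are the connected components of the arcs. -/
lemma eq_of_isArc_iff (h : ∀ i j, IsArc P i j ↔ IsArc Q i j) : P = Q := by
  have h0 : IsArc P = IsArc Q := by
    ext i j
    exact h i j
  have h1 : ∀ i, P.part i = Q.part i := fun i => by
    ext j
    rw [mem_part_iff_transGen, mem_part_iff_transGen, h0]
  have h2 : ∀ P Q : SetPartition n, (∀ i, P.part i = Q.part i) → P.parts ⊆ Q.parts := by
    intro P Q h B hB
    obtain ⟨i, hi⟩ := P.nonempty_of_mem_parts hB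
    rw [← P.part_eq_of_mem hB hi, h]
    exact Q.part_mem.2 (Finset.mem_univ _)
  exact Finpartition.ext ((h2 P Q h1).antisymm (h2 Q P fun i => (h1 i).symm))

open Classical in
/-- The set of arcs of a partition. -/
def arcSet (P : SetPartition n) : Finset (ℕ × ℕ) :=
  (Finset.univ.filter fun p : Fin n × Fin n => IsArc P p.1 p.2).image
    fun p => ((p.1 : ℕ), (p.2 : ℕ))

lemma mem_arcSet {i j : ℕ} :
    (i, j) ∈ arcSet P ↔ ∃ (hi : i < n) (hj : j < n), IsArc P ⟨i, hi⟩ ⟨j, hj⟩ := by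
  classical
  simp only [arcSet, Finset.mem_image, Finset.mem_filter, Finset.mem_univ, true_and,
    Prod.mk.injEq, Prod.exists]
  constructor
  · rintro ⟨i, j, h, rfl, rfl⟩
    exact ⟨i.2, j.2, h⟩
  · rintro ⟨hi, hj, h⟩
    exact ⟨_, _, h, rfl, rfl⟩

lemma mk_mem_arcSet {i j : Fin n} : ((i : ℕ), (j : ℕ)) ∈ arcSet P ↔ IsArc P i j := by
  rw [mem_arcSet]
  exact ⟨fun ⟨_, _, h⟩ => h, fun h => ⟨i.2, j.2, h⟩⟩

lemma arcSet_injective : Function.Injective (arcSet : SetPartition n → Finset (ℕ × ℕ)) :=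
  fun P Q h => eq_of_isArc_iff fun i j => by rw [← mk_mem_arcSet, h, mk_mem_arcSet]

lemma isArc_out {i j k : Fin n} (h : IsArc P i j) (h' : IsArc P i k) : j = k := by
  obtain ⟨h1, h2, h3⟩ := isArc_iff.1 h
  obtain ⟨h4, h5, h6⟩ := isArc_iff.1 h'
  refine le_antisymm (not_lt.1 fun h => h3 k h4 ⟨h5, h⟩) (not_lt.1 fun h => h6 j h1 ⟨h2, h⟩)

lemma isArc_inn {i j k : Fin n} (h : IsArc P i k) (h' : IsArc P j k) : i = j := by
  obtain ⟨h1, h2, h3⟩ := isArc_iff.1 h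
  obtain ⟨h4, h5, h6⟩ := isArc_iff.1 h'
  have hij : j ∈ P.part i := by
    rw [← part_eq_of_mem_part h1]
    exact mem_part_comm.1 h4
  exact le_antisymm (not_lt.1 fun h => h6 i (mem_part_comm.1 hij) ⟨h, h2⟩)
    (not_lt.1 fun h => h3 j hij ⟨h, h5⟩)

lemma isOpenSystem_arcSet : IsOpenSystem false n 0 ∅ (arcSet P) := by
  refine ⟨fun _ _ _ => Or.inr (Nat.zero_le _), ?_, fun _ _ _ => Nat.zero_le _, ?_, ?_, ?_,
    by simp, by simp⟩
  · intro i j h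
    obtain ⟨hi, hj, h⟩ := mem_arcSet.1 h
    exact (isArc_iff.1 h).2.1
  · intro i j h
    exact (mem_arcSet.1 h).2.1
  · intro i j k h h'
    obtain ⟨_, _, h⟩ := mem_arcSet.1 h
    obtain ⟨_, _, h'⟩ := mem_arcSet.1 h'
    exact congrArg Fin.val (isArc_out h h')
  · intro i j k h h'
    obtain ⟨_, _, h⟩ := mem_arcSet.1 h
    obtain ⟨_, _, h'⟩ := mem_arcSet.1 h'
    exact congrArg Fin.val (isArc_inn h h')

/-- An element of a block is an opener unless it is the largest and a closer unless it is the
smallest. Exactly one of the two holds for every element just when the block has two elements. -/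
lemma isMatching_iff : IsMatching P ↔ IsOpenSystem true n 0 ∅ (arcSet P) := by
  have h1 : ∀ p : Fin n, (∃ j, ((p : ℕ), j) ∈ arcSet P) ↔ ∃ j ∈ P.part p, p < j := by
    intro p
    constructor
    · rintro ⟨j, hj⟩
      obtain ⟨_, hj', h⟩ := mem_arcSet.1 hj
      exact ⟨⟨j, hj'⟩, (isArc_iff.1 h).1, (isArc_iff.1 h).2.1⟩
    · rintro ⟨j, hj, hpj⟩
      obtain ⟨s, hs, -⟩ := exists_isArc_of_lt hj hpj
      exact ⟨s, mk_mem_arcSet.2 hs⟩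
  have h2 : ∀ p : Fin n, (∃ i, (i, (p : ℕ)) ∈ arcSet P) ↔ ∃ i ∈ P.part p, i < p := by
    intro p
    constructor
    · rintro ⟨i, hi⟩
      obtain ⟨hi', _, h⟩ := mem_arcSet.1 hi
      exact ⟨⟨i, hi'⟩, mem_part_comm.1 (isArc_iff.1 h).1, (isArc_iff.1 h).2.1⟩
    · rintro ⟨i, hi, hip⟩
      obtain ⟨s, hs⟩ := exists_isArc_of_gt hi hip
      exact ⟨s, mk_mem_arcSet.2 hs⟩
  constructor
  · intro h
    have h0 := isOpenSystem_arcSet (P := P)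
    refine ⟨h0.src, h0.lt, h0.ge, h0.bd, h0.out, h0.inn, h0.dang, fun _ p _ hp => ?_⟩
    rw [h1 ⟨p, hp⟩, h2 ⟨p, hp⟩]
    generalize (⟨p, hp⟩ : Fin n) = p
    have hself : p ∈ P.part p := P.mem_part_self.2 (Finset.mem_univ _)
    obtain ⟨x, y, hxy, hB⟩ := Finset.card_eq_two.1 (h _ (P.part_mem.2 (Finset.mem_univ p)))
    rw [hB] at hself ⊢
    simp only [Finset.mem_insert, Finset.mem_singleton] at hself ⊢
    simp only [exists_eq_or_imp, exists_eq_left]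
    rcases hself with rfl | rfl
    · rcases lt_or_gt_of_ne hxy with h | h <;> simp [h, h.not_gt]
    · rcases lt_or_gt_of_ne hxy with h | h <;> simp [h, h.not_gt]
  · intro h B hB
    have h3 : ∀ p ∈ B, ¬ ((∃ j ∈ B, p < j) ↔ ∃ i ∈ B, i < p) := by
      intro p hp
      have := h.perf rfl p (Nat.zero_le _) p.2
      rwa [h1, h2, P.part_eq_of_mem hB hp] at this
    have hne := P.nonempty_of_mem_parts hB
    have hm := Finset.min'_mem B hne
    have hmin := fun x hx => Finset.min'_le B x hx
    set m := B.min' hne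
    have h4 : ¬ ∃ i ∈ B, i < m := fun ⟨i, hi, him⟩ => absurd (hmin i hi) (not_le.2 him)
    obtain ⟨q, hq, hmq⟩ : ∃ j ∈ B, m < j := by
      by_contra h5
      exact h3 m hm ⟨fun h => absurd h h5, fun h => absurd h h4⟩
    have h5 : ∀ r ∈ B, m < r → ∀ j ∈ B, ¬ r < j := fun r hr hmr j hj hrj =>
      h3 r hr ⟨fun _ => ⟨m, hm, hmr⟩, fun _ => ⟨j, hj, hrj⟩⟩
    rw [Finset.card_eq_two]
    refine ⟨m, q, hmq.ne, ?_⟩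
    ext r
    rw [Finset.mem_insert, Finset.mem_singleton]
    constructor
    · intro hr
      rcases eq_or_lt_of_le (hmin r hr) with h6 | h6
      · exact Or.inl h6.symm
      · exact Or.inr (le_antisymm (not_lt.1 (h5 q hq hmq r hr)) (not_lt.1 (h5 r hr h6 q hq)))
    · rintro (rfl | rfl)
      · exact hm
      · exact hq

open Classical in
/-- The first element of the block of `j`. -/
def root (A : Finset (ℕ × ℕ)) (j : ℕ) : ℕ :=
  if h : ∃ i, i < j ∧ (i, j) ∈ A then root A h.choose else j
termination_by j
decreasing_by exact h.choose_spec.1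

lemma root_le (A : Finset (ℕ × ℕ)) (j : ℕ) : root A j ≤ j := by
  induction j using Nat.strong_induction_on with
  | _ j ih =>
    rw [root]
    split_ifs with h
    · exact (ih _ h.choose_spec.1).trans h.choose_spec.1.le
    · exact le_rfl

variable {b : Bool} {N : ℕ} {A : Finset (ℕ × ℕ)}

lemma root_eq_of_mem (hA : IsOpenSystem b N 0 ∅ A) {i j : ℕ} (h : (i, j) ∈ A) :
    root A j = root A i := by
  have h1 : ∃ i, i < j ∧ (i, j) ∈ A := ⟨i, hA.lt _ _ h, h⟩
  rw [root, dif_pos h1, hA.inn _ _ _ h1.choose_spec.2 h]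

lemma le_of_reflTransGen (hA : IsOpenSystem b N 0 ∅ A) {i j : ℕ}
    (h : Relation.ReflTransGen (fun i j => (i, j) ∈ A) i j) : i ≤ j := by
  induction h with
  | refl => exact le_rfl
  | tail _ h ih => exact ih.trans (hA.lt _ _ h).le

/-- Let `k` be the predecessor of `j`. If `k < i`, the path from `k` to `i` would start with the
only arc out of `k`, which already jumps to `j > i`; otherwise a path from `i` to `k` extends by
`(k, j)`. -/
lemma transGen_of_root_eq (hA : IsOpenSystem b N 0 ∅ A) (j : ℕ) : ∀ i < j, root A i = root A j →
    Relation.TransGen (fun i j => (i, j) ∈ A) i j := by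
  induction j using Nat.strong_induction_on with
  | _ j ih =>
    intro i hij h
    obtain ⟨k, hkj, hk⟩ : ∃ k, k < j ∧ (k, j) ∈ A := by
      by_contra h1
      have h2 : root A j = j := by rw [root, dif_neg h1]
      have := root_le A i
      omega
    have hkr := root_eq_of_mem hA hk
    rcases lt_trichotomy k i with h1 | rfl | h1
    · have h2 := ih i hij k h1 (by rw [← hkr, h])
      obtain ⟨s, hs, hsi⟩ := Relation.TransGen.head'_iff.1 h2
      have h3 := hA.out _ _ _ hs hk
      have h4 := le_of_reflTransGen hA hsi
      omega
    · exact Relation.TransGen.single hk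
    · exact Relation.TransGen.tail (ih k hkj i h1 (by rw [h, hkr])) hk

lemma exists_arcSet_eq (hA : IsOpenSystem b N 0 ∅ A) : ∃ P : SetPartition N, arcSet P = A := by
  classical
  let s : Setoid (Fin N) := Setoid.ker fun x : Fin N => root A x
  let P : SetPartition N := Finpartition.ofSetoid s
  have hP : ∀ i j : Fin N, j ∈ P.part i ↔ root A i = root A j := fun i j =>
    Finpartition.mem_part_ofSetoid_iff_rel
  refine ⟨P, ?_⟩
  -- A path from `i` to `l` starts with the arc `(i, j)`, so no point strictly between `i` and `j`
  -- is in their block.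
  have hout : ∀ i j l, (i, j) ∈ A → i < l → l < j → root A i ≠ root A l := by
    intro i j l hij hil hlj h
    obtain ⟨t, ht, htl⟩ := Relation.TransGen.head'_iff.1 (transGen_of_root_eq hA l i hil h)
    have h1 := hA.out _ _ _ ht hij
    have h2 := le_of_reflTransGen hA htl
    omega
  ext ⟨i, j⟩
  rw [mem_arcSet]
  constructor
  · rintro ⟨hi, hj, h⟩
    obtain ⟨h1, h2, h3⟩ := isArc_iff.1 h
    rw [hP] at h1
    obtain ⟨t, ht, htj⟩ := Relation.TransGen.head'_iff.1 (transGen_of_root_eq hA j i h2 h1)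
    have h4 := le_of_reflTransGen hA htj
    rcases eq_or_lt_of_le h4 with rfl | h4
    · exact ht
    · exact absurd ⟨hA.lt _ _ ht, h4⟩
        (h3 ⟨t, hA.bd _ _ ht⟩ ((hP _ _).2 (root_eq_of_mem hA ht).symm))
  · intro h
    have hj := hA.bd _ _ h
    have hij := hA.lt _ _ h
    refine ⟨hij.trans hj, hj, isArc_iff.2 ⟨(hP _ _).2 (root_eq_of_mem hA h).symm, hij, ?_⟩⟩
    rintro l hl ⟨h1, h2⟩
    exact hout i j l h h1 h2 ((hP _ _).1 hl)

end ArcSets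

/-! ### Pattern avoidance for sets of arcs -/

/-- The set of arcs `A` avoids the pattern `τ`. -/
def ArcsAvoid {k : ℕ} (A : Finset (ℕ × ℕ)) (τ : Equiv.Perm (Fin k)) : Prop :=
  ¬ ∃ i : Fin (2 * k) → ℕ, StrictMono i ∧
    ∀ a : Fin k, (i ⟨(a : ℕ), by omega⟩, i ⟨2 * k - 1 - (τ a : ℕ), by omega⟩) ∈ A

/-- Each of the `2k` indices is an endpoint of one of the `k` arcs, so an occurrence in `ℕ` is one
in `Fin n`. -/
lemma lt_of_forall_mem {k N : ℕ} {A : Finset (ℕ × ℕ)} {τ : Equiv.Perm (Fin k)}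
    {i : Fin (2 * k) → ℕ} (hA : ∀ x y, (x, y) ∈ A → x < N ∧ y < N)
    (h : ∀ a : Fin k, (i ⟨(a : ℕ), by omega⟩, i ⟨2 * k - 1 - (τ a : ℕ), by omega⟩) ∈ A)
    (x : Fin (2 * k)) : i x < N := by
  by_cases hx : (x : ℕ) < k
  · exact (hA _ _ (h ⟨x, hx⟩)).1
  · have := (hA _ _ (h (τ.symm ⟨2 * k - 1 - x, by omega⟩))).2
    simp only [Equiv.apply_symm_apply] at this
    convert this using 2
    ext
    simp only
    omega

lemma avoids_iff {n k : ℕ} {P : SetPartition n} {τ : Equiv.Perm (Fin k)} :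
    Avoids P τ ↔ ArcsAvoid (arcSet P) τ := by
  rw [Avoids, ArcsAvoid, not_iff_not]
  constructor
  · rintro ⟨i, hi, h⟩
    exact ⟨fun x => i x, fun x y hxy => hi hxy, fun a => mk_mem_arcSet.2 (h a)⟩
  · rintro ⟨i, hi, h⟩
    have hlt := lt_of_forall_mem (N := n) (fun x y hxy => by
      obtain ⟨hx, hy, -⟩ := mem_arcSet.1 hxy
      exact ⟨hx, hy⟩) h
    exact ⟨fun x => ⟨i x, hlt x⟩, fun x y hxy => hi hxy, fun a => mk_mem_arcSet.1 (h a)⟩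

/-- The number of sets of arcs on `N` points that avoid every pattern in `S`; if `b` holds, only
perfect matchings are counted. -/
def numArcSets {k : ℕ} (b : Bool) (S : Set (Equiv.Perm (Fin k))) (N : ℕ) : ℕ :=
  {A : Finset (ℕ × ℕ) | IsOpenSystem b N 0 ∅ A ∧ ∀ τ ∈ S, ArcsAvoid A τ}.ncard

lemma numPartitions_eq {k : ℕ} (S : Set (Equiv.Perm (Fin k))) (n : ℕ) :
    numPartitions S n = numArcSets false S n := by
  rw [numPartitions, numArcSets, ← Set.ncard_image_of_injective _ arcSet_injective]
  congr 1
  ext A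
  simp only [Set.mem_image, Set.mem_ofPred_eq]
  constructor
  · rintro ⟨P, hP, rfl⟩
    exact ⟨isOpenSystem_arcSet, fun τ hτ => avoids_iff.1 (hP τ hτ)⟩
  · rintro ⟨h1, h2⟩
    obtain ⟨P, rfl⟩ := exists_arcSet_eq h1
    exact ⟨P, fun τ hτ => avoids_iff.2 (h2 τ hτ), rfl⟩

lemma numMatchings_eq {k : ℕ} (S : Set (Equiv.Perm (Fin k))) (n : ℕ) :
    numMatchings S n = numArcSets true S (2 * n) := by
  rw [numMatchings, numArcSets, ← Set.ncard_image_of_injective _ arcSet_injective]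
  congr 1
  ext A
  simp only [Set.mem_image, Set.mem_ofPred_eq]
  constructor
  · rintro ⟨P, ⟨hm, hP⟩, rfl⟩
    exact ⟨isMatching_iff.1 hm, fun τ hτ => avoids_iff.1 (hP τ hτ)⟩
  · rintro ⟨h1, h2⟩
    obtain ⟨P, rfl⟩ := exists_arcSet_eq h1
    exact ⟨P, ⟨isMatching_iff.2 h1, fun τ hτ => avoids_iff.2 (h2 τ hτ)⟩, rfl⟩

/-! ### Reflection -/

/-- The reflection `i ↦ N - 1 - i` of a set of arcs. -/
def mirror (N : ℕ) (A : Finset (ℕ × ℕ)) : Finset (ℕ × ℕ) :=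
  A.image fun p => (N - 1 - p.2, N - 1 - p.1)

section Mirror

variable {b : Bool} {N : ℕ} {A : Finset (ℕ × ℕ)}

lemma IsOpenSystem.lt_and_lt {t : ℕ} {L : Finset ℕ} (hA : IsOpenSystem b N t L A) (i j : ℕ)
    (h : (i, j) ∈ A) : i < N ∧ j < N :=
  ⟨(hA.lt _ _ h).trans (hA.bd _ _ h), hA.bd _ _ h⟩

lemma mem_mirror (hA : IsOpenSystem b N 0 ∅ A) {i j : ℕ} :
    (i, j) ∈ mirror N A ↔ i < N ∧ j < N ∧ (N - 1 - j, N - 1 - i) ∈ A := by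
  simp only [mirror, Finset.mem_image, Prod.exists, Prod.mk.injEq]
  constructor
  · rintro ⟨x, y, h, rfl, rfl⟩
    obtain ⟨hx, hy⟩ := hA.lt_and_lt _ _ h
    rw [show N - 1 - (N - 1 - x) = x by omega, show N - 1 - (N - 1 - y) = y by omega]
    exact ⟨by omega, by omega, h⟩
  · rintro ⟨hi, hj, h⟩
    exact ⟨_, _, h, by omega, by omega⟩

lemma isOpenSystem_mirror (hA : IsOpenSystem b N 0 ∅ A) : IsOpenSystem b N 0 ∅ (mirror N A) := by
  refine ⟨fun _ _ _ => Or.inr (Nat.zero_le _), ?_, fun _ _ _ => Nat.zero_le _, ?_, ?_, ?_,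
    by simp, ?_⟩
  · intro i j h
    rw [mem_mirror hA] at h
    have := hA.lt _ _ h.2.2
    omega
  · intro i j h
    rw [mem_mirror hA] at h
    exact h.2.1
  · intro i j k h h'
    rw [mem_mirror hA] at h h'
    have := hA.inn _ _ _ h.2.2 h'.2.2
    omega
  · intro i j k h h'
    rw [mem_mirror hA] at h h'
    have := hA.out _ _ _ h.2.2 h'.2.2
    omega
  · intro hb p _ hp
    have h := hA.perf hb (N - 1 - p) (Nat.zero_le _) (by omega)
    have h1 : (∃ j, (p, j) ∈ mirror N A) ↔ ∃ i, (i, N - 1 - p) ∈ A := by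
      simp only [mem_mirror hA]
      constructor
      · rintro ⟨j, -, -, h⟩
        exact ⟨_, h⟩
      · rintro ⟨i, h⟩
        have := hA.lt_and_lt _ _ h
        exact ⟨N - 1 - i, hp, by omega, by rwa [show N - 1 - (N - 1 - i) = i by omega]⟩
    have h2 : (∃ i, (i, p) ∈ mirror N A) ↔ ∃ j, (N - 1 - p, j) ∈ A := by
      simp only [mem_mirror hA]
      constructor
      · rintro ⟨j, -, -, h⟩
        exact ⟨_, h⟩
      · rintro ⟨i, h⟩
        have := hA.lt_and_lt _ _ h
        exact ⟨N - 1 - i, by omega, hp, by rwa [show N - 1 - (N - 1 - i) = i by omega]⟩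
    rw [h1, h2]
    tauto

lemma mirror_mirror (hA : IsOpenSystem b N 0 ∅ A) : mirror N (mirror N A) = A := by
  ext ⟨i, j⟩
  rw [mem_mirror (isOpenSystem_mirror hA), mem_mirror hA]
  constructor
  · rintro ⟨hi, hj, -, -, h⟩
    rwa [show N - 1 - (N - 1 - i) = i by omega, show N - 1 - (N - 1 - j) = j by omega] at h
  · intro h
    obtain ⟨hi, hj⟩ := hA.lt_and_lt _ _ h
    rw [show N - 1 - (N - 1 - i) = i by omega, show N - 1 - (N - 1 - j) = j by omega]
    exact ⟨hi, hj, by omega, by omega, h⟩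

/-- Reversed, an occurrence of `τ⁻¹` in the mirror image is an occurrence of `τ`: the arc with index
`τ a` becomes the arc with index `a`. -/
lemma arcsAvoid_mirror {k : ℕ} {τ : Equiv.Perm (Fin k)} (hA : IsOpenSystem b N 0 ∅ A)
    (h : ArcsAvoid A τ) : ArcsAvoid (mirror N A) τ⁻¹ := by
  rintro ⟨i, hi, hm⟩
  have hlt := lt_of_forall_mem (N := N) (isOpenSystem_mirror hA).lt_and_lt hm
  refine h ⟨fun x => N - 1 - i x.rev, fun x y hxy => ?_, fun a => ?_⟩
  · have h1 := hi (Fin.rev_lt_rev.2 hxy)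
    have h2 := hlt x.rev
    dsimp only
    omega
  · have h1 := hm (τ a)
    rw [mem_mirror hA] at h1
    obtain ⟨-, -, h1⟩ := h1
    have e1 : Fin.rev (⟨(a : ℕ), by omega⟩ : Fin (2 * k)) =
        ⟨2 * k - 1 - (τ⁻¹ (τ a) : Fin k), by omega⟩ := by
      ext
      simp only [Fin.val_rev, Equiv.Perm.inv_def, Equiv.symm_apply_apply]
      omega
    have e2 : Fin.rev (⟨2 * k - 1 - (τ a : ℕ), by omega⟩ : Fin (2 * k)) =
        ⟨(τ a : ℕ), by omega⟩ := by
      ext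
      simp only [Fin.val_rev]
      omega
    dsimp only
    rw [e1, e2]
    exact h1

lemma p123_inv : p123⁻¹ = p123 := by decide

lemma p231_inv : p231⁻¹ = p312 := by decide

lemma p312_inv : p312⁻¹ = p231 := by decide

lemma numArcSets_mirror (b : Bool) (N : ℕ) :
    numArcSets b {p123, p231} N = numArcSets b {p123, p312} N := by
  have h1 : ∀ A, IsOpenSystem b N 0 ∅ A → (∀ τ ∈ ({p123, p231} : Set _), ArcsAvoid A τ) →
      ∀ τ ∈ ({p123, p312} : Set _), ArcsAvoid (mirror N A) τ := by
    rintro A hA h τ (rfl | rfl)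
    · rw [← p123_inv]
      exact arcsAvoid_mirror hA (h _ (Or.inl rfl))
    · rw [← p231_inv]
      exact arcsAvoid_mirror hA (h _ (Or.inr rfl))
  have h2 : ∀ A, IsOpenSystem b N 0 ∅ A → (∀ τ ∈ ({p123, p312} : Set _), ArcsAvoid A τ) →
      ∀ τ ∈ ({p123, p231} : Set _), ArcsAvoid (mirror N A) τ := by
    rintro A hA h τ (rfl | rfl)
    · rw [← p123_inv]
      exact arcsAvoid_mirror hA (h _ (Or.inl rfl))
    · rw [← p312_inv]
      exact arcsAvoid_mirror hA (h _ (Or.inr rfl))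
  refine Set.ncard_congr (fun A _ => mirror N A) ?_ ?_ ?_
  · rintro A ⟨hA, h⟩
    exact ⟨isOpenSystem_mirror hA, h1 A hA h⟩
  · rintro A B ⟨hA, -⟩ ⟨hB, -⟩ h
    rw [← mirror_mirror hA, h, mirror_mirror hB]
  · rintro A ⟨hA, h⟩
    exact ⟨mirror N A, ⟨isOpenSystem_mirror hA, h2 A hA h⟩, mirror_mirror hA⟩

end Mirror

/-! ### The patterns `123` and `231` -/

lemma avoidsBoth_iff {A : Finset (ℕ × ℕ)} :
    AvoidsBoth A ↔ ∀ τ ∈ ({p123, p231} : Set _), ArcsAvoid A τ := by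
  have hmono : ∀ i : Fin (2 * 3) → ℕ, StrictMono i →
      i 0 < i 1 ∧ i 1 < i 2 ∧ i 2 < i 3 ∧ i 3 < i 4 ∧ i 4 < i 5 := fun i hi =>
    ⟨hi (by decide), hi (by decide), hi (by decide), hi (by decide), hi (by decide)⟩
  have hmono' : ∀ i₁ i₂ i₃ j₁ j₂ j₃ : ℕ, i₁ < i₂ → i₂ < i₃ → i₃ < j₁ → j₁ < j₂ → j₂ < j₃ →
      StrictMono (![i₁, i₂, i₃, j₁, j₂, j₃] : Fin (2 * 3) → ℕ) := by
    intro i₁ i₂ i₃ j₁ j₂ j₃ h1 h2 h3 h4 h5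
    refine Fin.strictMono_iff_lt_succ (n := 5).2 fun i => ?_
    fin_cases i <;> simpa
  constructor
  · rintro ⟨h1, h2⟩ τ (rfl | rfl) ⟨i, hi, h⟩
    · obtain ⟨a1, a2, a3, a4, a5⟩ := hmono i hi
      exact h1 _ _ _ _ _ _ a1 a2 a3 a4 a5 (h 0) (h 1) (h 2)
    · obtain ⟨a1, a2, a3, a4, a5⟩ := hmono i hi
      exact h2 _ _ _ _ _ _ a1 a2 a3 a4 a5 (h 0) (h 1) (h 2)
  · intro h
    constructor
    · intro i₁ i₂ i₃ j₁ j₂ j₃ h1 h2 h3 h4 h5 e1 e2 e3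
      refine h p123 (Or.inl rfl) ⟨_, hmono' i₁ i₂ i₃ j₁ j₂ j₃ h1 h2 h3 h4 h5, fun a => ?_⟩
      fin_cases a
      exacts [e1, e2, e3]
    · intro i₁ i₂ i₃ j₁ j₂ j₃ h1 h2 h3 h4 h5 e1 e2 e3
      refine h p231 (Or.inr rfl) ⟨_, hmono' i₁ i₂ i₃ j₁ j₂ j₃ h1 h2 h3 h4 h5, fun a => ?_⟩
      fin_cases a
      exacts [e1, e2, e3]

lemma numArcSets_eq_card (b : Bool) (N : ℕ) :
    numArcSets b {p123, p231} N = (completions b N 0 ∅ 0 0).card := by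
  rw [numArcSets, ← Set.ncard_coe_finset]
  congr 1
  ext A
  rw [Finset.mem_coe, mem_completions, Set.mem_ofPred_eq, ← avoidsBoth_iff]
  constructor
  · rintro ⟨h1, h2⟩
    exact ⟨h1, h2, ⟨by simp, by simp⟩⟩
  · rintro ⟨h1, h2, -⟩
    exact ⟨h1, h2⟩

/-! ### A board that distinguishes the two pairs -/

/-- The Ferrers board with columns of heights `5, 5, 5, 4, 4`. -/
def board : YoungDiagram where
  cells := (Finset.range 5 ×ˢ Finset.range 5).filter fun p => p.1 < 3 ∨ p.2 < 4
  isLowerSet := by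
    rintro ⟨a, b⟩ ⟨c, d⟩ h h1
    rw [Prod.mk_le_mk] at h
    simp only [Finset.coe_filter, Finset.mem_product, Finset.mem_range, Set.mem_ofPred_eq] at h1 ⊢
    omega

lemma mem_board {x y : ℕ} : (x, y) ∈ board.cells ↔ x < 5 ∧ y < 5 ∧ (x < 3 ∨ y < 4) := by
  simp [board, and_assoc]

/-- The rooks given by a permutation. -/
def graph (σ : Equiv.Perm (Fin 5)) : Finset (ℕ × ℕ) :=
  Finset.univ.image fun x : Fin 5 => ((x : ℕ), (σ x : ℕ))

lemma mem_graph {σ : Equiv.Perm (Fin 5)} {x y : ℕ} :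
    (x, y) ∈ graph σ ↔ ∃ i : Fin 5, (i : ℕ) = x ∧ (σ i : ℕ) = y := by
  simp [graph]

lemma graph_injective : Function.Injective graph := by
  intro σ τ h
  ext i
  have h1 : ((i : ℕ), (σ i : ℕ)) ∈ graph σ := mem_graph.2 ⟨i, rfl, rfl⟩
  rw [h] at h1
  obtain ⟨j, hj, h2⟩ := mem_graph.1 h1
  rw [Fin.val_inj] at hj
  rw [← h2, hj]

/-- The squares given by the permutation lie on `board`. -/
def OnBoard (σ : Equiv.Perm (Fin 5)) : Prop := ∀ i : Fin 5, i < 3 ∨ σ i < 4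

lemma isFullRookPlacement_board {R : Finset (ℕ × ℕ)} :
    IsFullRookPlacement board R ↔ ∃ σ, OnBoard σ ∧ graph σ = R := by
  constructor
  · rintro ⟨hR, hcol, hrow⟩
    have h1 : ∀ x : Fin 5, ∃ y : Fin 5, ((x : ℕ), (y : ℕ)) ∈ R := by
      intro x
      obtain ⟨y, hy, -⟩ := hcol x (mem_board.2 (by omega))
      exact ⟨⟨y, (mem_board.1 (hR hy)).2.1⟩, hy⟩
    choose f hf using h1
    have hinj : Function.Injective f := by
      intro x x' h
      obtain ⟨z, -, hz⟩ := hrow (f x) (mem_board.2 (by omega))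
      have h2 := hz _ (hf x)
      have h3 := hz x' (by rw [h]; exact hf x')
      exact Fin.ext (h2.trans h3.symm)
    refine ⟨Equiv.ofBijective f (Finite.injective_iff_bijective.1 hinj), fun i => ?_, ?_⟩
    · have := (mem_board.1 (hR (hf i))).2.2
      exact this
    · ext ⟨x, y⟩
      rw [mem_graph]
      constructor
      · rintro ⟨i, rfl, rfl⟩
        exact hf i
      · intro h
        have hx := (mem_board.1 (hR h)).1
        obtain ⟨z, -, hz⟩ := hcol x (mem_board.2 (by omega))
        exact ⟨⟨x, hx⟩, rfl, (hz _ (hf ⟨x, hx⟩)).trans (hz _ h).symm⟩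
  · rintro ⟨σ, hσ, rfl⟩
    refine ⟨?_, ?_, ?_⟩
    · rintro ⟨x, y⟩ h
      obtain ⟨i, rfl, rfl⟩ := mem_graph.1 h
      exact mem_board.2 ⟨i.2, (σ i).2, hσ i⟩
    · intro x hx
      refine ⟨σ ⟨x, (mem_board.1 hx).1⟩, mem_graph.2 ⟨_, rfl, rfl⟩, ?_⟩
      rintro y hy
      obtain ⟨i, rfl, rfl⟩ := mem_graph.1 hy
      rfl
    · intro y hy
      have hy5 := (mem_board.1 hy).2.1
      refine ⟨σ.symm ⟨y, hy5⟩, mem_graph.2 ⟨σ.symm ⟨y, hy5⟩, rfl, by simp⟩, ?_⟩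
      rintro x hx
      obtain ⟨i, rfl, rfl⟩ := mem_graph.1 hx
      simp

lemma RooksContain.mono {k : ℕ} {T T' : Finset (ℕ × ℕ)} {τ : Equiv.Perm (Fin k)} (h : T ⊆ T')
    (hT : RooksContain T τ) : RooksContain T' τ := by
  obtain ⟨c, r, hc, hr, h1⟩ := hT
  exact ⟨c, r, hc, hr, fun a => h (h1 a)⟩

lemma mem_rect {a b x y : ℕ} : (x, y) ∈ rect a b ↔ x < a ∧ y < b := by simp [rect]

/-- Every rectangle inside the board lies in one of the two maximal ones, at the corners `(3, 5)`
and `(5, 4)`. -/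
lemma rookAvoids_board {k : ℕ} (hk : 0 < k) {R : Finset (ℕ × ℕ)} {τ : Equiv.Perm (Fin k)} :
    RookAvoids board R τ ↔
      ¬ RooksContain (R ∩ rect 3 5) τ ∧ ¬ RooksContain (R ∩ rect 5 4) τ := by
  constructor
  · intro h
    refine ⟨h 3 5 ⟨?_, ?_⟩, h 5 4 ⟨?_, ?_⟩⟩
    · rintro ⟨x, y⟩ hxy
      rw [mem_rect] at hxy
      exact mem_board.2 (by omega)
    · rw [mem_board]; omega
    · rintro ⟨x, y⟩ hxy
      rw [mem_rect] at hxy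
      exact mem_board.2 (by omega)
    · rw [mem_board]; omega
  · rintro ⟨h1, h2⟩ a b ⟨hr, -⟩ h
    have hpos : 0 < a ∧ 0 < b := by
      obtain ⟨c, r, -, -, h3⟩ := h
      have := mem_rect.1 (Finset.mem_inter.1 (h3 ⟨0, hk⟩)).2
      omega
    have h3 := mem_board.1 (hr (mem_rect.2 (show a - 1 < a ∧ b - 1 < b by omega)))
    have hsub : ∀ {a' b'}, a ≤ a' → b ≤ b' → R ∩ rect a b ⊆ R ∩ rect a' b' := by
      intro a' b' ha hb
      refine Finset.inter_subset_inter_left ?_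
      rintro ⟨x, y⟩ hxy
      rw [mem_rect] at hxy ⊢
      omega
    by_cases ha : a ≤ 3
    · exact h1 (h.mono (hsub ha (by omega)))
    · exact h2 (h.mono (hsub (by omega) (by omega)))

/-- The permutation `σ` contains `τ` in the columns up to `a` and the rows up to `b`. -/
def PermContains (σ : Equiv.Perm (Fin 5)) (a b : ℕ) (τ : Equiv.Perm (Fin 3)) : Prop :=
  ∃ x y z : Fin 5, x < y ∧ y < z ∧ (z : ℕ) < a ∧
    (∀ i, ((σ (![x, y, z] i) : Fin 5) : ℕ) < b) ∧
    σ (![x, y, z] (τ.symm 0)) < σ (![x, y, z] (τ.symm 1)) ∧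
    σ (![x, y, z] (τ.symm 1)) < σ (![x, y, z] (τ.symm 2))

lemma rooksContain_graph {σ : Equiv.Perm (Fin 5)} {a b : ℕ} {τ : Equiv.Perm (Fin 3)} :
    RooksContain (graph σ ∩ rect a b) τ ↔ PermContains σ a b τ := by
  constructor
  · rintro ⟨c, r, hc, hr, h⟩
    have h1 : ∀ i, ∃ x : Fin 5, (x : ℕ) = c i ∧ (σ x : ℕ) = r (τ i) := fun i =>
      mem_graph.1 (Finset.mem_inter.1 (h i)).1
    have h2 : ∀ i, c i < a ∧ r (τ i) < b := fun i => mem_rect.1 (Finset.mem_inter.1 (h i)).2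
    choose x hx hσ using h1
    have hxx : ![x 0, x 1, x 2] = x := by
      ext i
      fin_cases i <;> rfl
    refine ⟨x 0, x 1, x 2, ?_, ?_, ?_, ?_⟩
    · rw [Fin.lt_def, hx, hx]; exact hc (by decide)
    · rw [Fin.lt_def, hx, hx]; exact hc (by decide)
    · rw [hx]; exact (h2 2).1
    · rw [hxx]
      refine ⟨fun i => by rw [hσ]; exact (h2 i).2, ?_, ?_⟩
      · rw [Fin.lt_def, hσ, hσ, τ.apply_symm_apply, τ.apply_symm_apply]
        exact hr (by decide)
      · rw [Fin.lt_def, hσ, hσ, τ.apply_symm_apply, τ.apply_symm_apply]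
        exact hr (by decide)
  · rintro ⟨x, y, z, hxy, hyz, hz, hb, h1, h2⟩
    refine ⟨fun i => ![x, y, z] i, fun i => σ (![x, y, z] (τ.symm i)), ?_, ?_, fun i => ?_⟩
    · refine Fin.strictMono_iff_lt_succ (n := 2).2 fun i => ?_
      fin_cases i
      exacts [hxy, hyz]
    · refine Fin.strictMono_iff_lt_succ (n := 2).2 fun i => ?_
      fin_cases i
      exacts [h1, h2]
    · rw [Finset.mem_inter, mem_graph, mem_rect]
      refine ⟨⟨![x, y, z] i, rfl, by simp⟩, ?_, ?_⟩
      · have : ∀ i, ![x, y, z] i ≤ z := by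
          intro i
          fin_cases i
          exacts [(hxy.trans hyz).le, hyz.le, le_rfl]
        exact lt_of_le_of_lt (this i) hz
      · simpa using hb i

/-- The placements on `board` that avoid `123` and `τ`, as permutations. -/
def GoodPerm (τ : Equiv.Perm (Fin 3)) (σ : Equiv.Perm (Fin 5)) : Prop :=
  OnBoard σ ∧ (¬ PermContains σ 3 5 p123 ∧ ¬ PermContains σ 5 4 p123) ∧
    ¬ PermContains σ 3 5 τ ∧ ¬ PermContains σ 5 4 τ

instance (τ : Equiv.Perm (Fin 3)) : DecidablePred (GoodPerm τ) := fun σ => by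
  unfold GoodPerm OnBoard PermContains
  infer_instance

lemma numPlacements_board (τ : Equiv.Perm (Fin 3)) :
    numPlacements board {p123, τ} = (Finset.univ.filter (GoodPerm τ)).card := by
  rw [numPlacements, ← Set.ncard_coe_finset, ← Set.ncard_image_of_injective _ graph_injective]
  congr 1
  ext R
  simp only [Set.mem_ofPred_eq, Finset.coe_filter, Finset.mem_univ, true_and, Set.mem_image,
    isFullRookPlacement_board]
  constructor
  · rintro ⟨⟨σ, hσ, rfl⟩, h⟩
    have h1 := (rookAvoids_board (by decide)).1 (h p123 (Or.inl rfl))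
    have h2 := (rookAvoids_board (by decide)).1 (h τ (Or.inr rfl))
    simp only [rooksContain_graph] at h1 h2
    exact ⟨σ, ⟨hσ, h1, h2⟩, rfl⟩
  · rintro ⟨σ, ⟨hσ, h1, h2⟩, rfl⟩
    refine ⟨⟨σ, hσ, rfl⟩, ?_⟩
    rintro _ (rfl | rfl)
    · rw [rookAvoids_board (by decide)]
      simpa only [rooksContain_graph] using h1
    · rw [rookAvoids_board (by decide)]
      simpa only [rooksContain_graph] using h2

set_option maxRecDepth 100000 in
theorem not_shapeWilfEquivalent : ¬ ShapeWilfEquivalent {p123, p231} {p123, p312} := by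
  intro h
  have h1 := h board
  rw [numPlacements_board, numPlacements_board] at h1
  revert h1
  decide +kernel

/-! ### The Narayana generating function -/

section Narayana

open DyckStep

lemma valleys_append (a b : DyckStep) (l₁ l₂ : List DyckStep) :
    ((l₁ ++ a :: b :: l₂).zip (l₁ ++ a :: b :: l₂).tail).count (D, U) =
      ((l₁ ++ [a]).zip (l₁ ++ [a]).tail).count (D, U) + (if (a, b) = (D, U) then 1 else 0) +
        ((b :: l₂).zip l₂).count (D, U) := by
  induction l₁ with
  | nil => simp [List.count_cons, add_comm]
  | cons c l₁ ih =>
    rcases l₁ with _ | ⟨d, l₁⟩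
    · simp [List.count_cons] at ih ⊢
      omega
    · simp only [List.cons_append, List.tail_cons, List.zip_cons_cons, List.count_cons] at ih ⊢
      omega

lemma valleys_zero : valleys 0 = 0 := rfl

/-- An initial up step or a final down step creates no valley, so the only new valley is at the
junction, when `q` is nonempty. -/
lemma valleys_nest_add (p q : DyckWord) :
    valleys (p.nest + q) = valleys p + valleys q + if q = 0 then 0 else 1 := by
  have hD : ∀ l : List DyckStep, ((l ++ [D]).zip (l ++ [D]).tail).count (D, U) =
      (l.zip l.tail).count (D, U) := by
    intro l
    rcases List.eq_nil_or_concat l with rfl | ⟨l, a, rfl⟩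
    · simp
    · have := valleys_append a D l []
      simpa using this
  have hU : ∀ l : List DyckStep, ((U :: l).zip (U :: l).tail).count (D, U) =
      (l.zip l.tail).count (D, U) := by
    rintro (_ | ⟨a, l⟩)
    · simp
    · simp
  have hn : valleys p.nest = valleys p := by
    have h : p.nest.toList = U :: (p.toList ++ [D]) := by simp [DyckWord.nest]
    rw [valleys, h, hU, hD, valleys]
  rcases eq_or_ne q 0 with rfl | hq
  · simp only [add_zero, if_true, hn, valleys_zero]
  · have hne := DyckWord.toList_ne_nil.2 hq
    obtain ⟨l, hl⟩ : ∃ l, q.toList = U :: l := by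
      refine ⟨q.toList.tail, ?_⟩
      rw [← q.head_eq_U hne, List.cons_head_tail]
    have h1 : (p.nest + q).toList = (U :: p.toList) ++ D :: U :: l := by
      change p.nest.toList ++ q.toList = _
      rw [hl]
      simp [DyckWord.nest]
    have h2 : p.nest.toList = (U :: p.toList) ++ [D] := by simp [DyckWord.nest]
    have h3 := valleys_append D U (U :: p.toList) l
    rw [← h1, ← h2] at h3
    rw [if_neg hq, valleys, h3, ← hn, valleys, valleys, hl]
    simp
    ring

/-- The Narayana polynomials. -/
def narayanaPoly (n : ℕ) : ℚ[X] :=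
  ∑ p : {p : DyckWord // p.semilength = n}, Polynomial.X ^ valleys p.1

lemma narayanaPoly_zero : narayanaPoly 0 = 1 := by
  have h : ∀ p : {p : DyckWord // p.semilength = 0}, p = ⟨0, DyckWord.semilength_zero⟩ := by
    rintro ⟨p, hp⟩
    refine Subtype.ext ?_
    by_contra h
    change ¬ p = 0 at h
    have := DyckWord.semilength_insidePart_lt h
    omega
  rw [narayanaPoly, Fintype.sum_eq_single ⟨0, DyckWord.semilength_zero⟩
    fun p hp => absurd (h p) hp, valleys_zero, pow_zero]

/-- First-return decomposition of Dyck paths. -/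
lemma narayanaPoly_succ (n : ℕ) : narayanaPoly (n + 1) =
    ∑ x ∈ Finset.HasAntidiagonal.antidiagonal n, narayanaPoly x.1 *
      (if x.2 = 0 then 1 else Polynomial.X * narayanaPoly x.2) := by
  have h1 : ∀ x ∈ Finset.HasAntidiagonal.antidiagonal n, narayanaPoly x.1 *
      (if x.2 = 0 then 1 else Polynomial.X * narayanaPoly x.2) =
      ∑ y : {p : DyckWord // p.semilength = x.1} × {p : DyckWord // p.semilength = x.2},
        (Polynomial.X : ℚ[X]) ^ valleys (y.1.1.nest + y.2.1) := by
    intro x _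
    have h2 : (if x.2 = 0 then 1 else Polynomial.X * narayanaPoly x.2) =
        ∑ q : {p : DyckWord // p.semilength = x.2},
          (Polynomial.X : ℚ[X]) ^ (valleys q.1 + if q.1 = 0 then 0 else 1) := by
      split_ifs with h
      · rw [h]
        conv_lhs => rw [← narayanaPoly_zero, narayanaPoly]
        refine Fintype.sum_congr _ _ fun q => ?_
        have : q.1 = 0 := by
          by_contra h0
          have := DyckWord.semilength_insidePart_lt h0
          have := q.2
          omega
        rw [if_pos this, add_zero]
      · rw [narayanaPoly, Finset.mul_sum]
        refine Fintype.sum_congr _ _ fun q => ?_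
        have : q.1 ≠ 0 := by
          intro h0
          have := q.2
          rw [h0, DyckWord.semilength_zero] at this
          exact h this.symm
        rw [if_neg this, pow_succ, mul_comm]
    rw [h2, narayanaPoly, Finset.sum_mul_sum, Fintype.sum_prod_type]
    refine Fintype.sum_congr _ _ fun p => Fintype.sum_congr _ _ fun q => ?_
    rw [valleys_nest_add, ← pow_add, add_assoc]
  rw [Finset.sum_congr rfl h1, narayanaPoly, Finset.sum_sigma']
  have hne : ∀ p : {p : DyckWord // p.semilength = n + 1}, p.1 ≠ 0 := by
    intro p h0
    have := p.2
    rw [h0, DyckWord.semilength_zero] at this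
    omega
  refine Finset.sum_bij' (fun p _ => ⟨(p.1.insidePart.semilength, p.1.outsidePart.semilength),
      ⟨p.1.insidePart, rfl⟩, ⟨p.1.outsidePart, rfl⟩⟩)
    (fun s hs => ⟨s.2.1.1.nest + s.2.2.1, by
      have h := Finset.HasAntidiagonal.mem_antidiagonal.1 (Finset.mem_sigma.1 hs).1
      rw [DyckWord.semilength_add, DyckWord.semilength_nest, s.2.1.2, s.2.2.2]
      omega⟩) ?_ ?_ ?_ ?_ ?_
  · intro p _
    refine Finset.mem_sigma.2 ⟨Finset.HasAntidiagonal.mem_antidiagonal.2 ?_, Finset.mem_univ _⟩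
    have := DyckWord.semilength_insidePart_add_semilength_outsidePart_add_one (hne p)
    have := p.2
    dsimp only
    omega
  · exact fun _ _ => Finset.mem_univ _
  · intro p _
    exact Subtype.ext (DyckWord.nest_insidePart_add_outsidePart (hne p))
  · rintro ⟨⟨i, j⟩, ⟨p, hp⟩, ⟨q, hq⟩⟩ _
    dsimp only at hp hq
    subst hp hq
    have e1 : (p.nest + q).insidePart = p := by
      rw [DyckWord.insidePart_add p.nest_ne_zero, DyckWord.insidePart_nest]
    have e2 : (p.nest + q).outsidePart = q := by
      rw [DyckWord.outsidePart_add p.nest_ne_zero, DyckWord.outsidePart_nest, zero_add]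
    have key : ∀ p' q' : DyckWord, p' = p → q' = q →
        (⟨(p'.semilength, q'.semilength), ⟨p', rfl⟩, ⟨q', rfl⟩⟩ : Σ x : ℕ × ℕ,
          {p : DyckWord // p.semilength = x.1} × {p : DyckWord // p.semilength = x.2}) =
        ⟨(p.semilength, q.semilength), ⟨p, rfl⟩, ⟨q, rfl⟩⟩ := by
      rintro _ _ rfl rfl
      rfl
    exact key _ _ e1 e2
  · intro p _
    dsimp only
    rw [DyckWord.nest_insidePart_add_outsidePart (hne p)]

lemma narayanaGF_eq : narayanaGF = 1 + PowerSeries.X * narayanaGF +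
    PowerSeries.C Polynomial.X * PowerSeries.X * narayanaGF * (narayanaGF - 1) := by
  have h : narayanaGF = PowerSeries.mk narayanaPoly := rfl
  have h2 : PowerSeries.X * narayanaGF +
      PowerSeries.C Polynomial.X * PowerSeries.X * narayanaGF * (narayanaGF - 1) =
      PowerSeries.X * (narayanaGF *
        (1 + PowerSeries.C Polynomial.X * (narayanaGF - 1))) := by ring
  rw [add_assoc, h2]
  ext1 n
  rcases n with _ | n
  · simp [h, narayanaPoly_zero]
  · rw [map_add, PowerSeries.coeff_succ_X_mul, PowerSeries.coeff_mul, h, PowerSeries.coeff_mk,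
      narayanaPoly_succ, PowerSeries.coeff_one, if_neg (Nat.succ_ne_zero n), zero_add]
    refine Finset.sum_congr rfl fun x _ => ?_
    rw [PowerSeries.coeff_mk, map_add, PowerSeries.coeff_C_mul, map_sub, PowerSeries.coeff_one,
      PowerSeries.coeff_mk]
    split_ifs with h0
    · rw [h0, narayanaPoly_zero]; simp
    · simp

lemma natDegree_narayanaPoly_le (n : ℕ) : (narayanaPoly n).natDegree ≤ n := by
  induction n using Nat.strong_induction_on with
  | _ n ih =>
    rcases n with _ | n
    · simp [narayanaPoly_zero]
    · rw [narayanaPoly_succ]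
      refine Polynomial.natDegree_sum_le_of_forall_le _ _ fun x hx => ?_
      have hx' := Finset.HasAntidiagonal.mem_antidiagonal.1 hx
      refine Polynomial.natDegree_mul_le.trans ?_
      have h1 := ih x.1 (by omega)
      split_ifs with h0
      · simp only [Polynomial.natDegree_one]
        omega
      · have h2 := ih x.2 (by omega)
        have h3 := Polynomial.natDegree_mul_le (p := Polynomial.X) (q := narayanaPoly x.2)
        rw [Polynomial.natDegree_X] at h3
        omega

end Narayana

/-! ### The root of the cubic -/

/-- A contraction of the power series has a fixed point; the coefficients of the fixed point are
coefficients of iterates. -/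
lemma exists_fixedPoint {R : Type*} [CommRing R] (Φ : R⟦X⟧ → R⟦X⟧)
    (h : ∀ F G n, PowerSeries.X ^ n ∣ F - G → PowerSeries.X ^ (n + 1) ∣ Φ F - Φ G) :
    ∃ H, Φ H = H ∧ ∀ n, PowerSeries.coeff n H = PowerSeries.coeff n (Φ^[n + 1] 0) := by
  have h1 : ∀ n k, (PowerSeries.X ^ n : R⟦X⟧) ∣ Φ^[n + k] 0 - Φ^[n] 0 := by
    intro n
    induction n with
    | zero => simp
    | succ n ih =>
      intro k
      rw [show n + 1 + k = (n + k) + 1 by ring, Function.iterate_succ_apply',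
        Function.iterate_succ_apply']
      exact h _ _ _ (ih k)
  have h2 : ∀ m n, m < n → PowerSeries.coeff m (Φ^[n] 0) = PowerSeries.coeff m (Φ^[m + 1] 0) := by
    intro m n hmn
    obtain ⟨k, rfl⟩ := Nat.exists_eq_add_of_le (Nat.succ_le_of_lt hmn)
    have := PowerSeries.X_pow_dvd_iff.1 (h1 (m + 1) k) m (Nat.lt_succ_self m)
    rwa [map_sub, sub_eq_zero] at this
  set H : R⟦X⟧ := PowerSeries.mk fun n => PowerSeries.coeff n (Φ^[n + 1] 0) with hH
  have h3 : ∀ n, PowerSeries.X ^ n ∣ H - Φ^[n] 0 := by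
    intro n
    rw [PowerSeries.X_pow_dvd_iff]
    intro m hm
    rw [map_sub, hH, PowerSeries.coeff_mk, h2 m n hm, sub_self]
  refine ⟨H, ?_, fun n => by rw [hH, PowerSeries.coeff_mk]⟩
  ext1 n
  have h4 := h _ _ _ (h3 n)
  rw [← Function.iterate_succ_apply' Φ] at h4
  have h5 := PowerSeries.X_pow_dvd_iff.1 h4 n (Nat.lt_succ_self n)
  rw [map_sub, sub_eq_zero] at h5
  rw [h5, hH, PowerSeries.coeff_mk]

/-- The cubic in terms of `z`, `w = v z` and `C`. -/
def cubic {R : Type*} [CommRing R] (z w C H : R) : R :=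
  w ^ 2 * H ^ 3 + (-2 * w + 2 * w * (z - w) + w ^ 2 * C) * H ^ 2 +
    (1 - 2 * (z - w) + (z - w) ^ 2 - w * C) * H + (-1 + w * C - (z - w) ^ 2 * C)

lemma map_cubic {R S : Type*} [CommRing R] [CommRing S] (f : R →+* S) (z w C H : R) :
    f (cubic z w C H) = cubic (f z) (f w) (f C) (f H) := by
  have h2 : f 2 = 2 := map_ofNat f 2
  simp [cubic, h2]

lemma cubic_mem {R : Type*} [CommRing R] (S : Subring R) {z w C H : R} (hz : z ∈ S) (hw : w ∈ S)
    (hC : C ∈ S) (hH : H ∈ S) : cubic z w C H ∈ S := by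
  lift z to S using hz
  lift w to S using hw
  lift C to S using hC
  lift H to S using hH
  exact map_cubic S.subtype z w C H ▸ (cubic z w C H).2

/-- The series `v z`. -/
def vz : ℚ[X]⟦X⟧ := PowerSeries.C Polynomial.X * PowerSeries.X

/-- The series `v` has a constant term of degree `1` and so is not in `dominated`, while `z` and `v
z` are; hence the form of `cubic`. -/
lemma isCubicRoot_iff {H : ℚ[X]⟦X⟧} :
    IsCubicRoot H ↔ cubic PowerSeries.X vz narayanaGF H = 0 := by
  rw [IsCubicRoot]
  have : ∀ a b : ℚ[X]⟦X⟧, a = b → (a = 0 ↔ b = 0) := by rintro a _ rfl; rfl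
  refine this _ _ ?_
  simp only [cubic, vz]
  ring

lemma cubic_sub_cubic {R : Type*} [CommRing R] (z w C F G : R) :
    cubic z w C F - cubic z w C G = (F - G) * (w ^ 2 * (F ^ 2 + F * G + G ^ 2) +
      (-2 * w + 2 * w * (z - w) + w ^ 2 * C) * (F + G) +
      (1 - 2 * (z - w) + (z - w) ^ 2 - w * C)) := by
  simp only [cubic]
  ring

/-- The second factor has constant term `1`. This gives uniqueness of the root and makes `F ↦ F -
cubic F` a contraction. -/
lemma cubic_step (F G : ℚ[X]⟦X⟧) : ∃ g : ℚ[X]⟦X⟧, cubic PowerSeries.X vz narayanaGF F -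
    cubic PowerSeries.X vz narayanaGF G = (F - G) * (1 + PowerSeries.X * g) := by
  rw [cubic_sub_cubic]
  obtain ⟨g, hg⟩ : (PowerSeries.X : ℚ[X]⟦X⟧) ∣ (vz ^ 2 * (F ^ 2 + F * G + G ^ 2) +
      (-2 * vz + 2 * vz * (PowerSeries.X - vz) + vz ^ 2 * narayanaGF) * (F + G) +
      (1 - 2 * (PowerSeries.X - vz) + (PowerSeries.X - vz) ^ 2 - vz * narayanaGF)) - 1 := by
    rw [PowerSeries.X_dvd_iff]
    simp [vz]
  exact ⟨g, by rw [← hg]; ring⟩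

lemma IsCubicRoot.unique {H H' : ℚ[X]⟦X⟧} (h : IsCubicRoot H) (h' : IsCubicRoot H') : H' = H := by
  rw [isCubicRoot_iff] at h h'
  obtain ⟨g, hg⟩ := cubic_step H' H
  rw [h, h', sub_self] at hg
  rcases mul_eq_zero.1 hg.symm with h1 | h1
  · exact sub_eq_zero.1 h1
  · have := congrArg PowerSeries.constantCoeff h1
    simp at this

/-! ### The substitution `v = 1 / z`, `z = z² / (1 - z)²` -/

/-- The series `∑ h_n(v) zⁿ` with `deg h_n ≤ n`. -/
def dominated : Subring ℚ[X]⟦X⟧ where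
  carrier := {F | ∀ n, (PowerSeries.coeff n F).natDegree ≤ n}
  mul_mem' := by
    intro F G hF hG n
    rw [PowerSeries.coeff_mul]
    refine Polynomial.natDegree_sum_le_of_forall_le _ _ fun x hx => ?_
    have := Finset.HasAntidiagonal.mem_antidiagonal.1 hx
    have h1 := hF x.1
    have h2 := hG x.2
    exact Polynomial.natDegree_mul_le.trans (by omega)
  one_mem' := by
    intro n
    rw [PowerSeries.coeff_one]
    split_ifs <;> simp
  add_mem' := by
    intro F G hF hG n
    rw [map_add]
    exact Polynomial.natDegree_add_le_of_degree_le (hF n) (hG n)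
  zero_mem' := by intro n; simp
  neg_mem' := by
    intro F hF n
    rw [map_neg, Polynomial.natDegree_neg]
    exact hF n

lemma X_mem_dominated : (PowerSeries.X : ℚ[X]⟦X⟧) ∈ dominated := by
  intro n
  rw [PowerSeries.coeff_X]
  split_ifs <;> simp

lemma vz_mem_dominated : vz ∈ dominated := by
  intro n
  rw [vz, PowerSeries.coeff_C_mul, PowerSeries.coeff_X]
  split_ifs with h
  · simp [h]
  · simp

lemma narayanaGF_mem_dominated : narayanaGF ∈ dominated := fun n => by
  rw [show narayanaGF = PowerSeries.mk narayanaPoly from rfl, PowerSeries.coeff_mk]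
  exact natDegree_narayanaPoly_le n

lemma exists_isCubicRoot : ∃ H ∈ dominated, IsCubicRoot H := by
  obtain ⟨H, h1, h2⟩ := exists_fixedPoint
    (fun F : ℚ[X]⟦X⟧ => F - cubic PowerSeries.X vz narayanaGF F) (by
      intro F G n h
      obtain ⟨g, hg⟩ := cubic_step F G
      have : F - cubic PowerSeries.X vz narayanaGF F - (G - cubic PowerSeries.X vz narayanaGF G) =
          (F - G) * PowerSeries.X * (-g) := by linear_combination -hg
      rw [this, pow_succ]
      exact (mul_dvd_mul_right h _).mul_right _)
  refine ⟨H, ?_, isCubicRoot_iff.2 (by linear_combination -h1)⟩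
  have h3 : ∀ F ∈ dominated, F - cubic PowerSeries.X vz narayanaGF F ∈ dominated := by
    intro F hF
    exact sub_mem hF (cubic_mem _ X_mem_dominated vz_mem_dominated narayanaGF_mem_dominated hF)
  have h4 : ∀ n, (fun F : ℚ[X]⟦X⟧ => F - cubic PowerSeries.X vz narayanaGF F)^[n] 0 ∈
      dominated := by
    intro n
    induction n with
    | zero => exact zero_mem _
    | succ n ih =>
      rw [Function.iterate_succ_apply']
      exact h3 _ ih
  intro n
  -- Each coefficient of `H` is a coefficient of an iterate, so the degree bound passes to the
  -- limit.
  rw [h2]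
  exact h4 (n + 1) n

section Substitution

/-- The series `z / (1 - z)²`. -/
def tau : ℚ⟦X⟧ := PowerSeries.X * ((1 - PowerSeries.X) ^ 2)⁻¹

lemma constantCoeff_one_sub_X_sq :
    PowerSeries.constantCoeff ((1 - PowerSeries.X) ^ 2 : ℚ⟦X⟧) ≠ 0 := by simp

lemma tau_mul : tau * (1 - PowerSeries.X) ^ 2 = PowerSeries.X := by
  rw [tau, mul_assoc, PowerSeries.inv_mul_cancel _ constantCoeff_one_sub_X_sq, mul_one]

lemma X_dvd_tau : PowerSeries.X ∣ tau := Dvd.intro _ rfl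

/-- The value of a power series with coefficients in `ℚ⟦z⟧` at `τ = z / (1 - z)²`. -/
def evalTau (F : ℚ⟦X⟧⟦X⟧) : ℚ⟦X⟧ :=
  PowerSeries.mk fun m => PowerSeries.coeff m ((PowerSeries.trunc (m + 1) F).eval tau)

lemma X_pow_dvd_eval {p : Polynomial ℚ⟦X⟧} {N : ℕ} (h : ∀ d < N, p.coeff d = 0) :
    PowerSeries.X ^ N ∣ p.eval tau := by
  obtain ⟨q, rfl⟩ := Polynomial.X_pow_dvd_iff.2 h
  rw [Polynomial.eval_mul, Polynomial.eval_pow, Polynomial.eval_X]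
  exact (pow_dvd_pow_of_dvd X_dvd_tau N).mul_right _

/-- Since `X ∣ tau`, modulo `X ^ N` the value depends on the truncation only. Multiplicativity thus
reduces to evaluation of polynomials. -/
lemma X_pow_dvd_evalTau_sub (F : ℚ⟦X⟧⟦X⟧) (N : ℕ) :
    PowerSeries.X ^ N ∣ evalTau F - (PowerSeries.trunc N F).eval tau := by
  rw [PowerSeries.X_pow_dvd_iff]
  intro m hm
  have h : PowerSeries.X ^ (m + 1) ∣
      ((PowerSeries.trunc (m + 1) F) - (PowerSeries.trunc N F)).eval tau := by
    refine X_pow_dvd_eval fun d hd => ?_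
    rw [Polynomial.coeff_sub, PowerSeries.coeff_trunc, PowerSeries.coeff_trunc, if_pos hd,
      if_pos (by omega), sub_self]
  rw [Polynomial.eval_sub] at h
  have h1 := PowerSeries.X_pow_dvd_iff.1 h m (Nat.lt_succ_self m)
  rw [map_sub, evalTau, PowerSeries.coeff_mk, ← map_sub, h1]

lemma eq_of_forall_X_pow_dvd_sub {F G : ℚ⟦X⟧} (h : ∀ N, PowerSeries.X ^ N ∣ F - G) : F = G := by
  ext m
  have := PowerSeries.X_pow_dvd_iff.1 (h (m + 1)) m (Nat.lt_succ_self m)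
  rwa [map_sub, sub_eq_zero] at this

/-- `evalTau` as a ring homomorphism. -/
def evalTauHom : ℚ⟦X⟧⟦X⟧ →+* ℚ⟦X⟧ where
  toFun := evalTau
  map_one' := by
    refine eq_of_forall_X_pow_dvd_sub fun N => ?_
    have h := X_pow_dvd_evalTau_sub 1 (N + 1)
    rw [PowerSeries.trunc_one, Polynomial.eval_one] at h
    exact (pow_dvd_pow _ (Nat.le_succ N)).trans h
  map_zero' := by
    ext m
    simp [evalTau]
  map_add' F G := by
    ext m
    simp [evalTau]
  map_mul' F G := by
    refine eq_of_forall_X_pow_dvd_sub fun N => ?_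
    have h1 := X_pow_dvd_evalTau_sub F N
    have h2 := X_pow_dvd_evalTau_sub G N
    have h3 := X_pow_dvd_evalTau_sub (F * G) N
    have h4 : PowerSeries.X ^ N ∣ (PowerSeries.trunc N (F * G) -
        PowerSeries.trunc N F * PowerSeries.trunc N G).eval tau := by
      refine X_pow_dvd_eval fun d hd => ?_
      rw [Polynomial.coeff_sub, sub_eq_zero, ← PowerSeries.trunc_trunc_mul_trunc,
        PowerSeries.coeff_trunc, if_pos hd, ← Polynomial.coe_mul, Polynomial.coeff_coe]
    rw [Polynomial.eval_sub, Polynomial.eval_mul] at h4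
    have h5 : evalTau (F * G) - evalTau F * evalTau G =
        (evalTau (F * G) - (PowerSeries.trunc N (F * G)).eval tau) +
        ((PowerSeries.trunc N (F * G)).eval tau -
          (PowerSeries.trunc N F).eval tau * (PowerSeries.trunc N G).eval tau) -
        (evalTau F - (PowerSeries.trunc N F).eval tau) * (PowerSeries.trunc N G).eval tau -
        evalTau F * (evalTau G - (PowerSeries.trunc N G).eval tau) := by ring
    rw [h5]
    exact dvd_sub (dvd_sub (dvd_add h3 h4) (h1.mul_right _)) (h2.mul_left _)

lemma reflect_sum {ι : Type*} (n : ℕ) (s : Finset ι) (f : ι → ℚ[X]) :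
    Polynomial.reflect n (∑ i ∈ s, f i) = ∑ i ∈ s, Polynomial.reflect n (f i) := by
  classical
  induction s using Finset.induction_on with
  | empty => simp
  | insert a s ha ih => rw [Finset.sum_insert ha, Finset.sum_insert ha, Polynomial.reflect_add, ih]

/-- Reversing the coefficients of a dominated series: `H(v, z) ↦ H(1 / u, u t)`. -/
def reflectHom : dominated →+* ℚ[X]⟦X⟧ where
  toFun F := PowerSeries.mk fun n => Polynomial.reflect n (PowerSeries.coeff n F.1)
  map_one' := by
    ext1 n
    rw [PowerSeries.coeff_mk, OneMemClass.coe_one, PowerSeries.coeff_one]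
    split_ifs with h
    · simp [h]
    · simp
  map_zero' := by
    ext1 n
    simp
  map_add' F G := by
    ext1 n
    simp [Polynomial.reflect_add]
  map_mul' F G := by
    ext1 n
    rw [PowerSeries.coeff_mk, PowerSeries.coeff_mul, Subring.coe_mul, PowerSeries.coeff_mul,
      reflect_sum]
    refine Finset.sum_congr rfl fun x hx => ?_
    rw [PowerSeries.coeff_mk, PowerSeries.coeff_mk, ← Finset.HasAntidiagonal.mem_antidiagonal.1 hx,
      Polynomial.reflect_mul _ _ (F.2 x.1) (G.2 x.2)]

/-- The substitution of `1 / z` for `v` and of `z² / (1 - z)²` for `z`. -/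
def substHom : dominated →+* ℚ⟦X⟧ :=
  (evalTauHom.comp (PowerSeries.map (Polynomial.coeToPowerSeries.ringHom (R := ℚ)))).comp
    reflectHom

/-- The `n`-th term of the substitution. -/
def term (F : ℚ[X]⟦X⟧) (n : ℕ) : ℚ⟦X⟧ :=
  (Polynomial.reflect n (PowerSeries.coeff n F) : ℚ[X]) * tau ^ n

lemma X_pow_dvd_term (F : ℚ[X]⟦X⟧) (n : ℕ) : PowerSeries.X ^ n ∣ term F n :=
  (pow_dvd_pow_of_dvd X_dvd_tau n).mul_left _

lemma coeff_substHom (F : dominated) (m : ℕ) :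
    PowerSeries.coeff m (substHom F) =
      ∑ n ∈ Finset.range (m + 1), PowerSeries.coeff m (term F.1 n) := by
  change PowerSeries.coeff m (evalTau _) = _
  rw [evalTau, PowerSeries.coeff_mk, Polynomial.eval, PowerSeries.eval₂_trunc_eq_sum_range, map_sum]
  refine Finset.sum_congr rfl fun n _ => ?_
  simp [reflectHom, term]

lemma substHom_eq_of_coeff {F : dominated} {k : ℕ}
    (h : ∀ n, n ≠ k → PowerSeries.coeff n F.1 = 0) : substHom F = term F.1 k := by
  ext m
  rw [coeff_substHom]
  have h0 : ∀ n, n ≠ k → term F.1 n = 0 := fun n hn => by simp [term, h n hn]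
  by_cases hk : k ≤ m
  · refine Finset.sum_eq_single k (fun n _ hn => by rw [h0 n hn, map_zero]) fun h => ?_
    exact absurd (Finset.mem_range.2 (by omega)) h
  · rw [PowerSeries.X_pow_dvd_iff.1 (X_pow_dvd_term F.1 k) m (by omega)]
    refine Finset.sum_eq_zero fun n hn => ?_
    rw [Finset.mem_range] at hn
    rw [h0 n (by omega), map_zero]

lemma substHom_X : substHom ⟨_, X_mem_dominated⟩ = PowerSeries.X * tau := by
  rw [substHom_eq_of_coeff (k := 1) fun n hn => by rw [PowerSeries.coeff_X, if_neg hn]]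
  simp [term, PowerSeries.coeff_X, Polynomial.reflect_one]

lemma substHom_vz : substHom ⟨_, vz_mem_dominated⟩ = tau := by
  rw [substHom_eq_of_coeff (k := 1) fun n hn => by
    simp only [vz]
    rw [PowerSeries.coeff_C_mul, PowerSeries.coeff_X, if_neg hn, mul_zero]]
  have : Polynomial.reflect 1 (Polynomial.X : ℚ[X]) = 1 := by
    simp
  simp [term, vz, this]

/-- As `deg h_n ≤ n`, the product `zⁿ h_n(1/z)` is the reversed polynomial at `z`, and `z²/(1 - z)²`
is `z` times `tau`. -/
lemma substTerm_eq (F : dominated) (n : ℕ) :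
    substTerm F.1 n = HahnSeries.ofPowerSeries ℤ ℚ (term F.1 n) := by
  set x : ℚ⸨X⸩ := HahnSeries.single 1 1 with hx
  have hX : HahnSeries.ofPowerSeries ℤ ℚ PowerSeries.X = x := HahnSeries.ofPowerSeries_X
  have hx0 : x ≠ 0 := by
    rw [← hX, Ne, map_eq_zero_iff _ HahnSeries.ofPowerSeries_injective]
    exact PowerSeries.X_ne_zero
  have hx1 : (1 - x) ^ 2 ≠ 0 := by
    rw [← hX, ← map_one (HahnSeries.ofPowerSeries ℤ ℚ), ← map_sub, ← map_pow, Ne,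
      map_eq_zero_iff _ HahnSeries.ofPowerSeries_injective]
    intro h
    exact constantCoeff_one_sub_X_sq (by rw [h, map_zero])
  have htau : HahnSeries.ofPowerSeries ℤ ℚ tau = x / (1 - x) ^ 2 := by
    rw [eq_div_iff hx1, ← hX, ← map_one (HahnSeries.ofPowerSeries ℤ ℚ), ← map_sub, ← map_pow,
      ← map_mul, tau_mul]
  have hpoly : ∀ P : ℚ[X], HahnSeries.ofPowerSeries ℤ ℚ (P : ℚ⟦X⟧) = Polynomial.aeval x P := by
    intro P
    have : (HahnSeries.ofPowerSeries ℤ ℚ).comp Polynomial.coeToPowerSeries.ringHom =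
        (Polynomial.aeval (R := ℚ) x : ℚ[X] →+* ℚ⸨X⸩) := by
      refine Polynomial.ringHom_ext' (Subsingleton.elim _ _) ?_
      simp [hx]
    exact RingHom.congr_fun this P
  have h : Polynomial.aeval x (Polynomial.reflect n (PowerSeries.coeff n F.1)) * x⁻¹ ^ n =
      Polynomial.aeval x⁻¹ (PowerSeries.coeff n F.1) := by
    let : Invertible x⁻¹ := invertibleOfNonzero (inv_ne_zero hx0)
    have := Polynomial.eval₂_reflect_mul_pow (algebraMap ℚ ℚ⸨X⸩) x⁻¹ n _ (F.2 n)
    rwa [invOf_eq_inv, inv_inv] at this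
  rw [substTerm, term, map_mul, map_pow, htau, hpoly]
  rw [← hx, ← h, mul_assoc, ← mul_pow]
  congr 2
  field_simp

/-- The term of index `n` is divisible by `zⁿ`, so only the indices up to `m` contribute to the
coefficient of `z^m`. -/
lemma isSubst_substHom (F : dominated) : IsSubst F.1 (substHom F) := by
  intro m
  have h : ∀ n, m.toNat < n → (substTerm F.1 n).coeff m = 0 := by
    intro n hn
    rw [substTerm_eq, PowerSeries.coeff_coe]
    split_ifs with hm
    · rfl
    · exact PowerSeries.X_pow_dvd_iff.1 (X_pow_dvd_term F.1 n) _ (by omega)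
  have hsub : ∀ n, (substTerm F.1 n).coeff m ≠ 0 → n ∈ Finset.range (m.toNat + 1) := by
    intro n hn
    by_contra h1
    rw [Finset.mem_range] at h1
    exact hn (h n (by omega))
  refine ⟨(Finset.finite_toSet (Finset.range (m.toNat + 1))).subset fun n hn => hsub n hn, ?_⟩
  rw [finsum_eq_sum_of_support_subset (s := Finset.range (m.toNat + 1)) _ fun n hn => hsub n hn,
    PowerSeries.coeff_coe]
  split_ifs with hm
  · refine (Finset.sum_eq_zero fun n _ => ?_).symm
    rw [substTerm_eq, PowerSeries.coeff_coe, if_pos hm]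
  · rw [coeff_substHom, show m.natAbs = m.toNat by omega]
    refine Finset.sum_congr rfl fun n _ => ?_
    rw [substTerm_eq, PowerSeries.coeff_coe, if_neg hm, show m.natAbs = m.toNat by omega]

end Substitution

/-! ### The generating functions -/

/-- The generating function of the completions of the empty state. -/
lemma exists_numArcSets_eq (b : Bool) (y z w C H : ℚ⟦X⟧)
    (hy : y * (1 - PowerSeries.C (if b then 0 else 1) * PowerSeries.X) = 1)
    (hz : z = (PowerSeries.X * y) ^ 2)
    (hw : w = z + PowerSeries.C (if b then 0 else 1) * (PowerSeries.X * y))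
    (hC : C = 1 + z * C + w * C * (C - 1)) (hH : cubic z w C H = 0) :
    ∃ s : ℚ⟦X⟧, s * (1 - w * H) = 1 ∧
      ∀ n, (numArcSets b {p123, p231} n : ℚ) = PowerSeries.coeff n (y * (1 + z * s * H)) := by
  have hy0 : y ≠ 0 := by
    rintro rfl
    simp at hy
  have hz0 : PowerSeries.constantCoeff z = 0 := by simp [hz]
  have hw0 : PowerSeries.constantCoeff w = 0 := by cases b <;> simp [hw, hz0]
  -- On constant terms the cubic reduces to `H - 1`.
  have hH0 : PowerSeries.constantCoeff H = 1 := by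
    have := congrArg PowerSeries.constantCoeff hH
    simp [cubic, hz0, hw0] at this
    linarith
  obtain ⟨K, h1, h2, h3⟩ := exists_kernelData z w C H
    (by rw [hz]; exact pow_ne_zero _ (mul_ne_zero PowerSeries.X_ne_zero hy0)) hz0 hw0 hH0 hC hH
  have sol := K.isTransferSolution (if b then 0 else 1) y hy (h1.trans hz)
    (by rw [h2, hw]; ring)
  refine ⟨K.s, ?_, fun n => ?_⟩
  · have := K.hs
    rw [h1, h2, h3] at this
    linear_combination this
  · rw [numArcSets_eq_card, card_completions_eq_coeff sol]
    congr 1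
    have : K.U 0 0 = K.u 0 := by simp [KernelData.U, KernelData.W]
    rw [this, K.u_zero, h1, h3]
    ring

/-- Here `y = 1` and `z = w = x²`, because `x` marks points and a matching of size `n` has `2n` of
them. Moreover `1 + z s H = s`. -/
lemma matchingGF_eq {H : ℚ[X]⟦X⟧} (hH : IsCubicRoot H) :
    matchingGF {p123, p231} = (1 - PowerSeries.X * atOne H)⁻¹ := by
  set φ : ℚ[X]⟦X⟧ →+* ℚ⟦X⟧ :=
    ((PowerSeries.expand 2 two_ne_zero : ℚ⟦X⟧ →ₐ[ℚ] ℚ⟦X⟧) : ℚ⟦X⟧ →+* ℚ⟦X⟧).comp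
      (PowerSeries.map (Polynomial.evalRingHom 1)) with hφ
  have hX : φ PowerSeries.X = PowerSeries.X ^ 2 := by simp [hφ]
  have hv : φ vz = PowerSeries.X ^ 2 := by simp [hφ, vz]
  have hC := congrArg φ narayanaGF_eq
  rw [← vz, map_add, map_add, map_mul, map_mul, map_mul, map_sub, map_one, hX, hv] at hC
  have hc := congrArg φ (isCubicRoot_iff.1 hH)
  rw [map_cubic, map_zero, hX, hv] at hc
  obtain ⟨s, hs, h⟩ := exists_numArcSets_eq true 1 _ _ _ _ (by simp) (by simp) (by simp) hC hc
  have hφH : φ H = PowerSeries.expand 2 two_ne_zero (atOne H) := rfl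
  have hinv : (1 - PowerSeries.X * atOne H)⁻¹ * (1 - PowerSeries.X * atOne H) = 1 :=
    PowerSeries.inv_mul_cancel _ (by simp)
  have hinv' := congrArg (PowerSeries.expand 2 two_ne_zero) hinv
  rw [map_mul, map_sub, map_mul, map_one, PowerSeries.expand_X, ← hφH] at hinv'
  have hs' : s = PowerSeries.expand 2 two_ne_zero (1 - PowerSeries.X * atOne H)⁻¹ := by
    linear_combination (-s) * hinv' +
      (PowerSeries.expand 2 two_ne_zero (1 - PowerSeries.X * atOne H)⁻¹) * hs
  have hs1 : (1 : ℚ⟦X⟧) * (1 + PowerSeries.X ^ 2 * s * φ H) = s := by linear_combination (-1) * hs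
  ext n
  rw [matchingGF, PowerSeries.coeff_mk, numMatchings_eq, h, hs1, hs',
    PowerSeries.coeff_expand_mul]

/-- The substitution sends `z` to `x tau = (x y)²` and `v z` to `tau = (x y)² + x y`, the two
parameters of the transfer equations with `c = 1`. -/
lemma partitionGF_eq {H : ℚ[X]⟦X⟧} (hd : H ∈ dominated) (hH : IsCubicRoot H) :
    partitionGF {p123, p231} = 1 + PowerSeries.X * (1 - PowerSeries.X) *
      ((1 - PowerSeries.X) ^ 2 - PowerSeries.X * substHom ⟨H, hd⟩)⁻¹ := by
  set C : dominated := ⟨_, narayanaGF_mem_dominated⟩ with hCdef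
  set Z : dominated := ⟨_, X_mem_dominated⟩ with hZdef
  set V : dominated := ⟨_, vz_mem_dominated⟩ with hVdef
  have hC : C = 1 + Z * C + V * C * (C - 1) := Subtype.ext narayanaGF_eq
  have hc : cubic Z V C ⟨H, hd⟩ = 0 := by
    refine Subtype.ext ?_
    exact (map_cubic dominated.subtype Z V C ⟨H, hd⟩).trans (isCubicRoot_iff.1 hH)
  have hC' := congrArg substHom hC
  rw [map_add, map_add, map_mul, map_mul, map_mul, map_sub, map_one, substHom_X, substHom_vz] at hC'
  have hc' := congrArg substHom hc
  rw [map_cubic, map_zero, substHom_X, substHom_vz] at hc'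
  generalize substHom ⟨H, hd⟩ = G at hc' ⊢
  set y : ℚ⟦X⟧ := (1 - PowerSeries.X)⁻¹ with hydef
  have hy : y * (1 - PowerSeries.X) = 1 := PowerSeries.inv_mul_cancel _ (by simp)
  have ht : tau = PowerSeries.X * y ^ 2 := by
    linear_combination y ^ 2 * tau_mul - tau * (y * (1 - PowerSeries.X) + 1) * hy
  obtain ⟨s, hs, h⟩ := exists_numArcSets_eq false y _ _ _ _ (by simpa using hy)
    (by rw [ht]; ring) (by rw [ht]; simp; linear_combination PowerSeries.X * y * hy) hC' hc'
  set D : ℚ⟦X⟧ := (1 - PowerSeries.X) ^ 2 - PowerSeries.X * G with hD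
  have hDinv : D⁻¹ * D = 1 := PowerSeries.inv_mul_cancel _ (by simp [hD])
  have h1 : partitionGF {p123, p231} = y * (1 + PowerSeries.X * tau * s * G) := by
    ext n
    rw [partitionGF, PowerSeries.coeff_mk, numPartitions_eq, h]
  have hsD : s * D = (1 - PowerSeries.X) ^ 2 := by
    linear_combination (1 - PowerSeries.X) ^ 2 * hs + s * G * tau_mul + s * hD
  have hD0 : D ≠ 0 := by
    intro h0
    rw [h0, mul_zero] at hDinv
    exact zero_ne_one hDinv
  rw [h1]
  refine mul_right_cancel₀ hD0 ?_
  linear_combination (y * PowerSeries.X * tau * G) * hsD + (y * PowerSeries.X * G) * tau_mul +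
    (1 - PowerSeries.X - PowerSeries.X * G) * hy - PowerSeries.X * (1 - PowerSeries.X) * hDinv +
    (y - 1) * hD

end ArcPatterns

end

open ArcPatterns
theorem mainTheorem8 :
    ∃ H : ℚ[X]⟦X⟧, IsCubicRoot H ∧ (∀ H' : ℚ[X]⟦X⟧, IsCubicRoot H' → H' = H) ∧
      (∃ G : ℚ⟦X⟧, IsSubst H G ∧
        ∀ S : Set (Equiv.Perm (Fin 3)), S = {p123, p231} ∨ S = {p123, p312} →
          matchingGF S = (1 - PowerSeries.X * atOne H)⁻¹ ∧
          partitionGF S =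
            1 + PowerSeries.X * (1 - PowerSeries.X) *
              ((1 - PowerSeries.X) ^ 2 - PowerSeries.X * G)⁻¹) ∧
      (∀ n : ℕ, numMatchings {p123, p231} n = numMatchings {p123, p312} n) ∧
      (∀ n : ℕ, numPartitions {p123, p231} n = numPartitions {p123, p312} n) ∧
      ¬ ShapeWilfEquivalent {p123, p231} {p123, p312} := by
  obtain ⟨H, hd, hH⟩ := exists_isCubicRoot
  have hm : ∀ n : ℕ, numMatchings {p123, p231} n = numMatchings {p123, p312} n := fun n => by
    rw [numMatchings_eq, numMatchings_eq, numArcSets_mirror]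
  have hp : ∀ n : ℕ, numPartitions {p123, p231} n = numPartitions {p123, p312} n := fun n => by
    rw [numPartitions_eq, numPartitions_eq, numArcSets_mirror]
  have hm' : matchingGF {p123, p231} = matchingGF {p123, p312} := by
    simp only [matchingGF, hm]
  have hp' : partitionGF {p123, p231} = partitionGF {p123, p312} := by
    simp only [partitionGF, hp]
  refine ⟨H, hH, fun H' hH' => hH.unique hH', ⟨substHom ⟨H, hd⟩, isSubst_substHom ⟨H, hd⟩, ?_⟩,
    hm, hp, not_shapeWilfEquivalent⟩
  rintro S (rfl | rfl)
  · exact ⟨matchingGF_eq hH, partitionGF_eq hd hH⟩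
  · rw [← hm', ← hp']
    exact ⟨matchingGF_eq hH, partitionGF_eq hd hH⟩
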